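/- Conventions. A super-ring is a $\mathbb{Z}/2$-graded ring with unity $A=A_0\oplus A_1$; all super-rings are super-commutative, i.e. $rs=sr$ whenever $r\in A_0$ and $s\in A_0\cup A_1$, and $s^2=0$ for every $s\in A_1$. A super-ideal is a $\mathbb{Z}/2$-graded ideal; it is maximal if the quotient by it is a field. $A$ is Noetherian if its super-ideals satisfy the ascending chain condition, and local if it has a unique maximal super-ideal $\mathfrak m$. Put $I_A=AA_1$, the ideal generated by $A_1$, and $\overline A=A/I_A$, which is a commutative ring. Elements $y_1,\dots,y_s\in A_1$ form a system of odd parameters if $\mathrm{Kdim}(A_0)=\mathrm{Kdim}\bigl(A_0/\mathrm{Ann}_{A_0}(y_1\cdots y_s)\bigr)$, where $\mathrm{Kdim}$ denotes Krull dimension (for $s=0$ the product is $1$). Let $\mathrm{Ksdim}_0(A)=\mathrm{Kdim}(A_0)$, and let $\mathrm{Ksdim}_1(A)$ be the largest length $s$ of a system of odd parameters. A local Noetherian super-ring $(A,\mathfrak m)$ with residue field $K=A/\mathfrak m$ is called regular if $$\mathrm{Ksdim}_0(A)=\dim_K (\mathfrak m/\mathfrak m^2)_0\quad\text{and}\quad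 \mathrm{Ksdim}_1(A)=\dim_K (\mathfrak m/\mathfrak m^2)_1 ,$$ where $(\mathfrak m/\mathfrak m^2)_i$ is the component of parity $i$ of $\mathfrak m/\mathfrak m^2$. Let $\mathrm{gr}_{I_A}(A)=\bigoplus_{n\ge 0} I_A^n/I_A^{n+1}$, a graded $\overline A$-algebra, and let $\lambda_A:\wedge_{\overline A}(I_A/I_A^2)\to \mathrm{gr}_{I_A}(A)$ be the $\overline A$-algebra map induced by the inclusion of $I_A/I_A^2$ as the component of degree $1$. Proposition. For a local Noetherian super-ring $A$ the following are equivalent: (a) $A$ is regular; (b) (i) $\overline A$ is a regular local ring, (ii) the $\overline A$-module $I_A/I_A^2$ is free, and (iii) $\lambda_A$ is an isomorphism; (b') (i) $\overline A$ is a regular local ring, (ii) the $\overline A$-module $I_A/I_A^2$ is free of rank $\mathrm{Ksdim}_1(A)$, and (iii) $\lambda_A$ is an isomorphism. -/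

import Mathlib

/-! ### The associated graded ring of a two-sided ideal of a (not necessarily commutative) ring -/

section AssocGraded

variable {A : Type*} [Ring A] (I : Ideal A)

/-- The quotient `I ^ n / I ^ (n + 1)`, for an ideal `I` (with `I ^ 0 = A`). -/
abbrev GrPiece (n : ℕ) : Type _ := ↥(I ^ n) ⧸ (I ^ (n + 1)).submoduleOf (I ^ n)

namespace GrPiece

/-- The class in `I ^ n / I ^ (n + 1)` of an element of `I ^ n`. -/
abbrev mk (n : ℕ) (x : ↥(I ^ n)) : GrPiece I n := Submodule.Quotient.mk x

variable {I}

theorem mk_eq_mk_iff {n : ℕ} {x y : ↥(I ^ n)} :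
    mk I n x = mk I n y ↔ (x : A) - y ∈ I ^ (n + 1) := by
  rw [Submodule.Quotient.eq]; rfl

theorem mk_surjective (n : ℕ) : Function.Surjective (mk I n) :=
  Submodule.Quotient.mk_surjective _

theorem sigma_mk_eq {m n : ℕ} (h : m = n) (x : ↥(I ^ m)) (y : ↥(I ^ n)) (hxy : (x : A) = y) :
    (GradedMonoid.mk m (mk I m x) : GradedMonoid (GrPiece I)) = GradedMonoid.mk n (mk I n y) := by
  subst h
  obtain rfl : x = y := Subtype.ext hxy
  rfl

variable [I.IsTwoSided]

theorem mul_mem_pow {m n : ℕ} {x y : A} (hx : x ∈ I ^ m) (hy : y ∈ I ^ n) :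
    x * y ∈ I ^ (m + n) := by
  rw [Ideal.IsTwoSided.pow_add]
  exact Ideal.mul_mem_mul hx hy

theorem isTorsionBySet (n : ℕ) : Module.IsTorsionBySet A (GrPiece I n) (I : Set A) := by
  rw [Module.isTorsionBySet_quotient_iff]
  intro x r hr
  change r * (x : A) ∈ I ^ (n + 1)
  rw [Ideal.IsTwoSided.pow_succ]
  exact Ideal.mul_mem_mul hr x.2

/-- `I ^ n / I ^ (n + 1)` is a module over `A / I`, through left multiplication. -/
instance instModuleQuotient (n : ℕ) : Module (A ⧸ I) (GrPiece I n) :=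
  (isTorsionBySet n).module

/-- The multiplication
`I ^ m / I ^ (m + 1) × I ^ n / I ^ (n + 1) → I ^ (m + n) / I ^ (m + n + 1)`
induced by the multiplication of `A`. -/
def mul {m n : ℕ} (a : GrPiece I m) (b : GrPiece I n) : GrPiece I (m + n) :=
  Quotient.liftOn₂ a b (fun x y => mk I (m + n) ⟨(x : A) * (y : A), mul_mem_pow x.2 y.2⟩) (by
    intro x y x' y' h h'
    have hx : (x : A) - x' ∈ I ^ (m + 1) := mk_eq_mk_iff.1 (Quotient.sound h)
    have hy : (y : A) - y' ∈ I ^ (n + 1) := mk_eq_mk_iff.1 (Quotient.sound h')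
    rw [mk_eq_mk_iff]
    change (x : A) * y - x' * y' ∈ I ^ (m + n + 1)
    have e : (x : A) * y - x' * y' = (x - x') * y + x' * (y - y') := by noncomm_ring
    rw [e]
    refine add_mem ?_ ?_
    · have := mul_mem_pow hx y.2
      rwa [show m + 1 + n = m + n + 1 by omega] at this
    · have := mul_mem_pow x'.2 hy
      rwa [← add_assoc] at this)

instance instGMul : GradedMonoid.GMul (GrPiece I) where
  mul := mul

instance instGOne : GradedMonoid.GOne (GrPiece I) where
  one := mk I 0 ⟨1, by rw [Submodule.pow_zero, Ideal.one_eq_top]; trivial⟩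

instance instGRing : DirectSum.GRing (GrPiece I) where
  mul_zero {m n} a := by
    obtain ⟨x, rfl⟩ := mk_surjective m a
    exact congrArg (mk I _) (Subtype.ext (mul_zero (x : A)))
  zero_mul {m n} b := by
    obtain ⟨y, rfl⟩ := mk_surjective n b
    exact congrArg (mk I _) (Subtype.ext (zero_mul (y : A)))
  mul_add {m n} a b c := by
    obtain ⟨x, rfl⟩ := mk_surjective m a
    obtain ⟨y, rfl⟩ := mk_surjective n b
    obtain ⟨z, rfl⟩ := mk_surjective n c
    exact congrArg (mk I _) (Subtype.ext (mul_add (x : A) y z))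
  add_mul {m n} a b c := by
    obtain ⟨x, rfl⟩ := mk_surjective m a
    obtain ⟨y, rfl⟩ := mk_surjective m b
    obtain ⟨z, rfl⟩ := mk_surjective n c
    exact congrArg (mk I _) (Subtype.ext (add_mul (x : A) y z))
  one_mul := by
    rintro ⟨n, a⟩
    obtain ⟨x, rfl⟩ := mk_surjective n a
    exact sigma_mk_eq (zero_add n) _ _ (one_mul (x : A))
  mul_one := by
    rintro ⟨n, a⟩
    obtain ⟨x, rfl⟩ := mk_surjective n a
    exact sigma_mk_eq (add_zero n) _ _ (mul_one (x : A))
  mul_assoc := by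
    rintro ⟨l, a⟩ ⟨m, b⟩ ⟨n, c⟩
    obtain ⟨x, rfl⟩ := mk_surjective l a
    obtain ⟨y, rfl⟩ := mk_surjective m b
    obtain ⟨z, rfl⟩ := mk_surjective n c
    exact sigma_mk_eq (add_assoc l m n) _ _ (mul_assoc (x : A) y z)
  natCast k := mk I 0 ⟨(k : A), by rw [Submodule.pow_zero, Ideal.one_eq_top]; trivial⟩
  natCast_zero := congrArg (mk I _) (Subtype.ext Nat.cast_zero)
  natCast_succ k := congrArg (mk I _) (Subtype.ext (Nat.cast_succ k))
  intCast k := mk I 0 ⟨(k : A), by rw [Submodule.pow_zero, Ideal.one_eq_top]; trivial⟩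
  intCast_ofNat k := congrArg (mk I _) (Subtype.ext (Int.cast_natCast k))
  intCast_negSucc_ofNat k := congrArg (mk I _) (Subtype.ext (Int.cast_negSucc k))

end GrPiece

/-- The associated graded ring `gr_I(A) = ⨁ n, I ^ n / I ^ (n + 1)`. -/
abbrev AssocGr : Type _ := DirectSum ℕ (GrPiece I)

end AssocGraded

/-! ### Super-commutative super-rings

A super-ring is a ring `A` with a `ℤ/2`-grading `𝒜`, that is, `A = 𝒜 0 ⊕ 𝒜 1`. -/

section SuperRing

variable {A : Type*} [Ring A] (𝒜 : ZMod 2 → AddSubgroup A) [GradedRing 𝒜]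

/-- Super-commutativity: even elements commute with homogeneous ones, and odd elements have
square zero. -/
class IsSuperCommutative : Prop where
  even_mul_even : ∀ r ∈ 𝒜 0, ∀ s ∈ 𝒜 0, r * s = s * r
  even_mul_odd : ∀ r ∈ 𝒜 0, ∀ s ∈ 𝒜 1, r * s = s * r
  odd_mul_self : ∀ s ∈ 𝒜 1, s * s = 0

/-- A super-ring is Noetherian if its super-ideals (the graded ideals) satisfy the ascending chain
condition. -/
class IsNoetherianSuperRing : Prop where
  wellFoundedGT : WellFoundedGT (HomogeneousIdeal 𝒜)

/-- The ideal `A * 𝒜 1` generated by the odd elements. -/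
def oddIdeal : Ideal A := Ideal.span (𝒜 1 : Set A)

namespace SuperRing

theorem eq_even_add_odd (a : A) :
    a = (DirectSum.decompose 𝒜 a 0 : A) + (DirectSum.decompose 𝒜 a 1 : A) := by
  classical
  conv_lhs => rw [← DirectSum.sum_support_decompose 𝒜 a]
  rw [Finset.sum_subset (Finset.subset_univ _)]
  · exact Fin.sum_univ_two (fun i : ZMod 2 => ((DirectSum.decompose 𝒜 a i : 𝒜 i) : A))
  · intro i _ hi
    simpa using hi

theorem exists_even_add_odd (a : A) : ∃ x ∈ 𝒜 0, ∃ y ∈ 𝒜 1, a = x + y :=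
  ⟨_, (DirectSum.decompose 𝒜 a 0).2, _, (DirectSum.decompose 𝒜 a 1).2, eq_even_add_odd 𝒜 a⟩

theorem oddIdeal_isHomogeneous : (oddIdeal 𝒜).IsHomogeneous 𝒜 :=
  Ideal.homogeneous_span 𝒜 _ fun _ hx => ⟨1, hx⟩

variable [IsSuperCommutative 𝒜]

theorem even_comm {r : A} (hr : r ∈ 𝒜 0) (a : A) : r * a = a * r := by
  obtain ⟨x, hx, y, hy, rfl⟩ := exists_even_add_odd 𝒜 a
  rw [mul_add, add_mul, IsSuperCommutative.even_mul_even r hr x hx,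
    IsSuperCommutative.even_mul_odd r hr y hy]

theorem odd_anticomm {r s : A} (hr : r ∈ 𝒜 1) (hs : s ∈ 𝒜 1) : r * s = -(s * r) := by
  have h := IsSuperCommutative.odd_mul_self (𝒜 := 𝒜) (r + s) (add_mem hr hs)
  rw [mul_add, add_mul, add_mul, IsSuperCommutative.odd_mul_self r hr,
    IsSuperCommutative.odd_mul_self s hs, zero_add, add_zero] at h
  exact eq_neg_of_add_eq_zero_right h

theorem isTwoSided_of_isHomogeneous {I : Ideal A} (hI : I.IsHomogeneous 𝒜) : I.IsTwoSided := by
  refine ⟨fun {a} b ha => ?_⟩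
  have h0 : (DirectSum.decompose 𝒜 a 0 : A) ∈ I := hI 0 ha
  have h1 : (DirectSum.decompose 𝒜 a 1 : A) ∈ I := hI 1 ha
  rw [eq_even_add_odd 𝒜 a, add_mul]
  refine add_mem ?_ ?_
  · rw [even_comm 𝒜 (DirectSum.decompose 𝒜 a 0).2]
    exact I.mul_mem_left b h0
  · obtain ⟨x, hx, y, hy, rfl⟩ := exists_even_add_odd 𝒜 b
    rw [mul_add, ← even_comm 𝒜 hx, odd_anticomm 𝒜 (DirectSum.decompose 𝒜 a 1).2 hy]
    exact add_mem (I.mul_mem_left x h1) (I.neg_mem (I.mul_mem_left y h1))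

instance instIsTwoSidedHomogeneous (P : HomogeneousIdeal 𝒜) : P.toIdeal.IsTwoSided :=
  isTwoSided_of_isHomogeneous 𝒜 P.isHomogeneous

instance instIsTwoSidedOddIdeal : (oddIdeal 𝒜).IsTwoSided :=
  isTwoSided_of_isHomogeneous 𝒜 (oddIdeal_isHomogeneous 𝒜)

/-- The even part `𝒜 0` is a commutative ring. -/
instance instCommRingEven : CommRing (𝒜 0) :=
  { (inferInstance : Ring (𝒜 0)) with
    mul_comm := fun r s => Subtype.ext (even_comm 𝒜 r.2 (s : A)) }

theorem exists_even_mk_eq (c : A ⧸ oddIdeal 𝒜) :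
    ∃ x ∈ 𝒜 0, Ideal.Quotient.mk (oddIdeal 𝒜) x = c := by
  obtain ⟨a, rfl⟩ := Ideal.Quotient.mk_surjective c
  obtain ⟨x, hx, y, hy, rfl⟩ := exists_even_add_odd 𝒜 a
  refine ⟨x, hx, ?_⟩
  have hy' : y ∈ oddIdeal 𝒜 := Ideal.subset_span hy
  rw [map_add, Ideal.Quotient.eq_zero_iff_mem.2 hy', add_zero]

/-- The quotient of `A` by the ideal generated by the odd elements is a commutative ring. -/
instance instCommRingBar : CommRing (A ⧸ oddIdeal 𝒜) :=
  { Ideal.Quotient.ring (oddIdeal 𝒜) with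
    mul_comm := fun a b => by
      obtain ⟨x, hx, rfl⟩ := exists_even_mk_eq 𝒜 a
      obtain ⟨y, rfl⟩ := Ideal.Quotient.mk_surjective b
      exact congrArg (Ideal.Quotient.mk (oddIdeal 𝒜)) (even_comm 𝒜 hx y) }

end SuperRing

variable [IsSuperCommutative 𝒜]

/-- A super-ideal is maximal if the quotient by it is a field. -/
def IsMaximalSuperIdeal (P : HomogeneousIdeal 𝒜) : Prop := IsField (A ⧸ P.toIdeal)

/-- A super-ring is local if it has exactly one maximal super-ideal. -/
class IsLocalSuperRing : Prop where
  existsUnique_maximal : ∃! P : HomogeneousIdeal 𝒜, IsMaximalSuperIdeal 𝒜 P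

/-- The maximal super-ideal `𝔪` of a local super-ring. -/
noncomputable def maximalSuperIdeal [IsLocalSuperRing 𝒜] : HomogeneousIdeal 𝒜 :=
  (IsLocalSuperRing.existsUnique_maximal (𝒜 := 𝒜)).choose

/-- For `P` a maximal super-ideal with residue field `K = A / P`: the component of parity `i` of the
super-vector space `P / P ^ 2` over `K`, that is, the subspace of the classes of the elements
of `P` of parity `i`. -/
def cotangentComponent (P : HomogeneousIdeal 𝒜) (i : ZMod 2) :
    Submodule (A ⧸ P.toIdeal) (GrPiece P.toIdeal 1) :=
  Submodule.span (A ⧸ P.toIdeal)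
    {v | ∃ x : ↥(P.toIdeal ^ 1), (x : A) ∈ 𝒜 i ∧ GrPiece.mk P.toIdeal 1 x = v}

/-- The annihilator in the even part `𝒜 0` of an element of `A`. -/
def evenAnnihilator (a : A) : Ideal (𝒜 0) where
  carrier := {r | (r : A) * a = 0}
  add_mem' {r s} hr hs := by
    change ((r : A) + s) * a = 0
    rw [add_mul, hr, hs, add_zero]
  zero_mem' := zero_mul a
  smul_mem' c r hr := by
    change ((c : A) * r) * a = 0
    rw [mul_assoc, hr, mul_zero]

/-- The odd elements `y 0, …, y (s - 1)` form a system of odd parameters if dividing `𝒜 0` by the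
annihilator of their product does not lower the Krull dimension. -/
def IsSystemOfOddParameters {s : ℕ} (y : Fin s → 𝒜 1) : Prop :=
  ringKrullDim (𝒜 0) =
    ringKrullDim (𝒜 0 ⧸ evenAnnihilator 𝒜 (List.ofFn fun i => (y i : A)).prod)

/-- The even Krull dimension of a super-ring. -/
noncomputable def evenKrullDim : WithBot ℕ∞ := ringKrullDim (𝒜 0)

/-- The odd Krull dimension of a super-ring: the largest length of a system of odd parameters. -/
noncomputable def oddKrullDim : ℕ∞ :=
  ⨆ (s : ℕ) (_ : ∃ y : Fin s → 𝒜 1, IsSystemOfOddParameters 𝒜 y), (s : ℕ∞)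

/-- A local (Noetherian) super-ring is regular if its Krull super-dimension equals the
super-dimension of `𝔪 / 𝔪 ^ 2` over the residue field `A / 𝔪`. -/
def IsRegularLocalSuperRing [IsLocalSuperRing 𝒜] : Prop :=
  evenKrullDim 𝒜 = (Module.finrank (A ⧸ (maximalSuperIdeal 𝒜).toIdeal)
    (cotangentComponent 𝒜 (maximalSuperIdeal 𝒜) 0) : ℕ) ∧
  oddKrullDim 𝒜 = (Module.finrank (A ⧸ (maximalSuperIdeal 𝒜).toIdeal)
    (cotangentComponent 𝒜 (maximalSuperIdeal 𝒜) 1) : ℕ)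

/-! ### The associated graded algebra of the odd ideal, and the map from the exterior algebra -/

namespace SuperRing

/-- `gr(A)`, for the ideal generated by the odd elements, is an algebra over its component of
degree zero. -/
instance instGAlgebra : DirectSum.GAlgebra (A ⧸ oddIdeal 𝒜) (GrPiece (oddIdeal 𝒜)) where
  toFun := QuotientAddGroup.lift (oddIdeal 𝒜).toAddSubgroup
    { toFun := fun a => GrPiece.mk (oddIdeal 𝒜) 0
        ⟨a, by rw [Submodule.pow_zero, Ideal.one_eq_top]; trivial⟩
      map_zero' := rfl
      map_add' := fun _ _ => rfl }
    (fun a ha => by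
      refine (GrPiece.mk_eq_mk_iff (y := 0)).2 ?_
      change a - 0 ∈ (oddIdeal 𝒜) ^ (0 + 1)
      rw [sub_zero, zero_add, Submodule.pow_one]
      exact ha)
  map_one := rfl
  map_mul r s := by
    obtain ⟨a, rfl⟩ := Ideal.Quotient.mk_surjective r
    obtain ⟨b, rfl⟩ := Ideal.Quotient.mk_surjective s
    exact GrPiece.sigma_mk_eq rfl ⟨a * b, _⟩ ⟨a * b, _⟩ rfl
  commutes r x := by
    obtain ⟨n, x⟩ := x
    obtain ⟨a, ha, rfl⟩ := exists_even_mk_eq 𝒜 r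
    obtain ⟨b, rfl⟩ := GrPiece.mk_surjective n x
    exact GrPiece.sigma_mk_eq (Nat.add_comm 0 n) ⟨a * b, _⟩ ⟨b * a, _⟩ (even_comm 𝒜 ha (b : A))
  smul_def r x := by
    obtain ⟨n, x⟩ := x
    obtain ⟨a, rfl⟩ := Ideal.Quotient.mk_surjective r
    obtain ⟨b, rfl⟩ := GrPiece.mk_surjective n x
    exact GrPiece.sigma_mk_eq (Nat.zero_add n).symm (a • b) ⟨a * b, _⟩ rfl

theorem exists_odd_sub_mem {a : A} (ha : a ∈ oddIdeal 𝒜) :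
    ∃ y ∈ 𝒜 1, a - y ∈ oddIdeal 𝒜 ^ 2 := by
  induction ha using Submodule.span_induction with
  | mem y hy => exact ⟨y, hy, by simp⟩
  | zero => exact ⟨0, zero_mem _, by simp⟩
  | add a b _ _ iha ihb =>
    obtain ⟨y, hy, h⟩ := iha
    obtain ⟨z, hz, h'⟩ := ihb
    refine ⟨y + z, add_mem hy hz, ?_⟩
    rw [add_sub_add_comm]
    exact add_mem h h'
  | smul c a _ iha =>
    obtain ⟨y, hy, h⟩ := iha
    obtain ⟨u, hu, v, hv, rfl⟩ := exists_even_add_odd 𝒜 c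
    refine ⟨u * y, by simpa using SetLike.mul_mem_graded hu hy, ?_⟩
    have e : (u + v) • a - u * y = (u + v) * (a - y) + v * y := by
      rw [smul_eq_mul]; noncomm_ring
    rw [e]
    refine add_mem (Ideal.mul_mem_left _ _ h) ?_
    have hv' : v ∈ oddIdeal 𝒜 ^ 1 := by
      rw [Submodule.pow_one]; exact Ideal.subset_span hv
    have hy' : y ∈ oddIdeal 𝒜 ^ 1 := by
      rw [Submodule.pow_one]; exact Ideal.subset_span hy
    exact GrPiece.mul_mem_pow hv' hy'

theorem lof_mul_self (v : GrPiece (oddIdeal 𝒜) 1) :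
    DirectSum.lof (A ⧸ oddIdeal 𝒜) ℕ (GrPiece (oddIdeal 𝒜)) 1 v *
      DirectSum.lof (A ⧸ oddIdeal 𝒜) ℕ (GrPiece (oddIdeal 𝒜)) 1 v = 0 := by
  obtain ⟨x, rfl⟩ := GrPiece.mk_surjective 1 v
  have hx : (x : A) ∈ oddIdeal 𝒜 := (Submodule.pow_one (oddIdeal 𝒜)).le x.2
  obtain ⟨y, hy, h⟩ := exists_odd_sub_mem 𝒜 hx
  have hy' : y ∈ oddIdeal 𝒜 ^ 1 := by
    rw [Submodule.pow_one]; exact Ideal.subset_span hy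
  have e : GrPiece.mk (oddIdeal 𝒜) 1 x = GrPiece.mk (oddIdeal 𝒜) 1 ⟨y, hy'⟩ :=
    GrPiece.mk_eq_mk_iff.2 h
  rw [e, DirectSum.lof_eq_of, DirectSum.of_mul_of]
  have e' : GradedMonoid.GMul.mul (GrPiece.mk (oddIdeal 𝒜) 1 ⟨y, hy'⟩)
      (GrPiece.mk (oddIdeal 𝒜) 1 ⟨y, hy'⟩) = 0 :=
    congrArg (GrPiece.mk (oddIdeal 𝒜) (1 + 1))
      (Subtype.ext (IsSuperCommutative.odd_mul_self (𝒜 := 𝒜) y hy))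
  rw [e', map_zero]

end SuperRing

/-- The algebra map from the exterior algebra of `I / I ^ 2` over `A / I` to `gr_I(A)`, where `I` is
the ideal generated by the odd elements, extending the inclusion of `I / I ^ 2` as the component
of degree one. -/
noncomputable def exteriorToGr :
    ExteriorAlgebra (A ⧸ oddIdeal 𝒜) (GrPiece (oddIdeal 𝒜) 1) →ₐ[A ⧸ oddIdeal 𝒜]
      AssocGr (oddIdeal 𝒜) :=
  ExteriorAlgebra.lift (A ⧸ oddIdeal 𝒜)
    ⟨DirectSum.lof (A ⧸ oddIdeal 𝒜) ℕ (GrPiece (oddIdeal 𝒜)) 1, SuperRing.lof_mul_self 𝒜⟩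

end SuperRing

/-! ### Regular local rings: integrality and dimension of quotients. -/

section RegularLocalRing

open IsLocalRing

/-! Write `J` for the kernel of `A₀ → Ā`, and let `x₁, …, x_t` be a minimal system of generators of
the `A₀`-module `A₁`. Odd elements are nilpotent, so `J` lies in every prime and `A₀` and `Ā` have
the same dimension. The even part of `𝔪 / 𝔪²` is the cotangent space of `Ā`, because the even part
of `I_A` lies in `A₁² ⊆ 𝔪²`; the odd part is `A₁ / 𝔪₀A₁`, of dimension `t` by Nakayama. So `A` is
regular if and only if `Ā` is regular and `Ksdim₁(A) = t` (`isRegularLocalSuperRing_iff`).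

Products of `n` odd elements come from the `n`-th exterior power of `A₁`. Hence more than `t` odd
elements have product zero, `I_A^(t+1) = 0`, and every product of `t` odd elements is an even
multiple of `x₁⋯x_t`. So `Ksdim₁(A) ≤ t`, and equality forces `A₀ / Ann(x₁⋯x_t)` to have the
dimension of `A₀`. The annihilator contains `J`, and `Ā = A₀ / J` is a domain when regular, so any
larger ideal would lower the dimension: the annihilator equals `J`
(`evenAnnihilator_le_ker_of_oddKrullDim_eq`).

In other words the top product generates a free `Ā`-module. An algebra map out of the exterior
algebra of a free module of rank `t` is injective once it is so on the top power
(`ExteriorAlgebra.injective_of_top`). Applied to `Āᵗ → I_A / I_A²` this gives freeness, and then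
injectivity of `λ_A`; surjectivity always holds. Conversely, odd lifts of a basis of `I_A / I_A²`
generate `A₁` by Nakayama, and injectivity of `λ_A` puts the annihilator of their product inside
`J`, so they form a system of odd parameters of the maximal length. -/

/-- Dividing a regular local ring by an element of `𝔪 \ 𝔪 ^ 2` lowers the number of generators of
the maximal ideal. -/
theorem IsLocalRing.spanFinrank_maximalIdeal_quotient_lt {R : Type*} [CommRing R] [IsLocalRing R]
    [IsNoetherianRing R] {x : R} (hx : x ∈ maximalIdeal R) (hx2 : x ∉ maximalIdeal R ^ 2)
    [IsLocalRing (R ⧸ Ideal.span {x})] :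
    (maximalIdeal (R ⧸ Ideal.span {x})).spanFinrank < (maximalIdeal R).spanFinrank := by
  classical
  set v : CotangentSpace R := (maximalIdeal R).toCotangent ⟨x, hx⟩ with hv
  have hv0 : v ≠ 0 := by
    rw [hv, Ne, Ideal.toCotangent_eq_zero]
    exact hx2
  have hli : LinearIndepOn (ResidueField R) id ({v} : Set (CotangentSpace R)) :=
    LinearIndepOn.singleton hv0
  have hspan := (Module.Basis.extend hli).span_eq
  rw [Module.Basis.range_extend] at hspan
  let B := Module.Basis.extend hli
  set S := hli.extend (Set.subset_univ _)
  have hvS : v ∈ S := hli.subset_extend _ rfl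
  have hfin : Finite S := Module.Finite.finite_basis B
  have hcard : S.ncard = (maximalIdeal R).spanFinrank := by
    rw [spanFinrank_maximalIdeal_eq_finrank_cotangentSpace, Module.finrank_eq_nat_card_basis B]
    rfl
  have hsurj := (maximalIdeal R).toCotangent_surjective
  choose σ₀ hσ₀ using hsurj
  -- The lift of `v` is forced to be `x`, so that one generator of the maximal ideal dies in the
  -- quotient.
  let σ : CotangentSpace R → maximalIdeal R := Function.update σ₀ v ⟨x, hx⟩
  have hσ : ∀ w, (maximalIdeal R).toCotangent (σ w) = w := by
    intro w
    by_cases h : w = v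
    · subst h; simp [σ, hv]
    · simp [σ, h, hσ₀]
  have hσv : (σ v : R) = x := by simp [σ]
  have htop : Submodule.span R (σ '' S) = ⊤ := by
    rw [← CotangentSpace.span_image_eq_top_iff, ← Set.image_comp]
    have : ((maximalIdeal R).toCotangent ∘ σ) = id := funext hσ
    rw [this, Set.image_id, hspan]
  have hm : maximalIdeal R = Ideal.span ((fun w => (σ w : R)) '' S) := by
    have h := congrArg (Submodule.map (maximalIdeal R).subtype) htop
    rw [Submodule.map_span, Submodule.map_top, Submodule.range_subtype, ← Set.image_comp] at h
    exact h.symm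
  have hmap : maximalIdeal (R ⧸ Ideal.span {x}) =
      Ideal.span ((fun w => Ideal.Quotient.mk (Ideal.span {x}) (σ w : R)) '' (S \ {v})) := by
    have h1 : maximalIdeal (R ⧸ Ideal.span {x}) =
        (maximalIdeal R).map (Ideal.Quotient.mk (Ideal.span {x})) :=
      (IsLocalRing.map_maximalIdeal_of_surjective _ Ideal.Quotient.mk_surjective).symm
    rw [h1]
    conv_lhs => rw [hm, Ideal.map_span, ← Set.image_comp]
    apply le_antisymm
    · rw [Ideal.span_le]
      rintro _ ⟨w, hw, rfl⟩
      by_cases h : w = v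
      · have : (Ideal.Quotient.mk (Ideal.span {x})) (σ w : R) = 0 := by
          rw [h, hσv, Ideal.Quotient.eq_zero_iff_mem]
          exact Ideal.mem_span_singleton_self x
        simp [this]
      · exact Ideal.subset_span ⟨w, ⟨hw, h⟩, rfl⟩
    · exact Ideal.span_mono (Set.image_mono Set.sdiff_subset)
  have hfin' : (S \ {v}).Finite := Set.Finite.sdiff hfin
  calc _ ≤ (S \ {v}).ncard := by
        rw [hmap]
        exact (Submodule.spanFinrank_span_le_ncard_of_finite (hfin'.image _)).trans
          (Set.ncard_image_le hfin')
    _ < S.ncard := Set.ncard_sdiff_singleton_lt_of_mem hvS hfin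
    _ = _ := hcard

/-- A regular local ring is a domain. -/
theorem IsRegularLocalRing.isDomain (R : Type*) [CommRing R] [IsRegularLocalRing R] :
    IsDomain R := by
  induction h : (maximalIdeal R).spanFinrank using Nat.strong_induction_on generalizing R with
  | _ d ih =>
  have hdim : (d : WithBot ℕ∞) = ringKrullDim R := by
    rw [← h]; exact IsRegularLocalRing.spanFinrank_maximalIdeal
  by_cases hbot : maximalIdeal R = ⊥
  · exact (isField_iff_maximalIdeal_eq.2 hbot).isDomain
  have hsq : ¬ maximalIdeal R ≤ maximalIdeal R ^ 2 := by
    intro hle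
    refine hbot (Submodule.eq_bot_of_le_smul_of_le_jacobson_bot (maximalIdeal R) _
      (IsNoetherian.noetherian _) ?_ (IsLocalRing.maximalIdeal_le_jacobson _))
    rwa [smul_eq_mul, ← sq]
  have hd : d ≠ 0 := by
    rintro rfl
    exact hbot ((Submodule.spanFinrank_eq_zero_iff_eq_bot (IsNoetherian.noetherian _)).1 h)
  have hmin : ∀ p ∈ minimalPrimes R, ¬ maximalIdeal R ≤ p := by
    intro p hp hle
    have hpp : p.IsPrime := hp.1.1
    have hpm : p = maximalIdeal R := le_antisymm (le_maximalIdeal hpp.ne_top) hle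
    have h0 : (maximalIdeal R).height = 0 := by
      rw [Ideal.height_eq_zero_iff, ← hpm]; exact hp
    have := maximalIdeal_height_eq_ringKrullDim (R := R)
    rw [h0, ← hdim] at this
    exact hd (by exact_mod_cast this.symm)
  -- Prime avoidance tolerates two ideals that are not prime; `𝔪 ^ 2` fills both places.
  obtain ⟨x, hx, hx2, hxmin⟩ : ∃ x ∈ maximalIdeal R, x ∉ maximalIdeal R ^ 2 ∧
      ∀ p ∈ minimalPrimes R, x ∉ p := by
    by_contra! hcon
    have hfin := minimalPrimes.finite_of_isNoetherianRing R
    have hsub : (maximalIdeal R : Set R) ⊆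
        ⋃ p ∈ (↑(insert (maximalIdeal R ^ 2) hfin.toFinset) : Set (Ideal R)), (p : Set R) := by
      intro x hx
      by_cases hx2 : x ∈ maximalIdeal R ^ 2
      · exact Set.mem_biUnion (by simp) hx2
      · obtain ⟨p, hp, hxp⟩ := hcon x hx hx2
        exact Set.mem_biUnion (by simp [hp]) hxp
    obtain ⟨p, hp, hle⟩ := (Ideal.subset_union_prime (f := fun p : Ideal R => p)
      (maximalIdeal R ^ 2) (maximalIdeal R ^ 2) (by
        intro p hp hne _
        have hp' : p ∈ minimalPrimes R := by simpa [hne] using hp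
        exact hp'.1.1)).1 hsub
    rw [Finset.mem_insert] at hp
    rcases hp with rfl | hp
    · exact hsq hle
    · exact hmin p (by simpa using hp) hle
  have hxtop : Ideal.span {x} ≠ ⊤ := by
    rw [Ne, Ideal.span_singleton_eq_top]
    exact hx
  have : Nontrivial (R ⧸ Ideal.span {x}) := Ideal.Quotient.nontrivial_iff.2 hxtop
  have : IsLocalRing (R ⧸ Ideal.span {x}) :=
    IsLocalRing.of_surjective' _ Ideal.Quotient.mk_surjective
  have hlt := IsLocalRing.spanFinrank_maximalIdeal_quotient_lt hx hx2
  rw [h] at hlt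
  have hdimle : ringKrullDim R ≤ ringKrullDim (R ⧸ Ideal.span {x}) + 1 := by
    have h1 := ringKrullDim_le_ringKrullDim_quotient_add_encard {x} (R := R) (by
      rw [IsLocalRing.ringJacobson_eq_maximalIdeal]
      simpa using hx)
    simpa using h1
  have hreg : IsRegularLocalRing (R ⧸ Ideal.span {x}) := by
    refine IsRegularLocalRing.of_spanFinrank_maximalIdeal_le _ ?_
    have h2 : ((maximalIdeal (R ⧸ Ideal.span {x})).spanFinrank : WithBot ℕ∞) + 1 ≤
        ringKrullDim (R ⧸ Ideal.span {x}) + 1 := by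
      refine le_trans ?_ hdimle
      rw [← hdim]
      exact_mod_cast hlt
    exact ENat.WithBot.add_le_add_one_right_iff.1 h2
  have hdom := ih _ hlt (R ⧸ Ideal.span {x}) rfl
  have hprime : (Ideal.span {x}).IsPrime := (Ideal.Quotient.isDomain_iff_prime _).1 hdom
  -- A minimal prime `q` inside the prime `(x)` does not contain `x`, so `q = x q`, and Nakayama
  -- gives `q = 0`.
  obtain ⟨q, hq, hqx⟩ := Ideal.exists_minimalPrimes_le (bot_le : ⊥ ≤ Ideal.span {x})
  have hqp : q.IsPrime := hq.1.1
  have hq0 : q = ⊥ := by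
    refine Submodule.eq_bot_of_le_smul_of_le_jacobson_bot (maximalIdeal R) _
      (IsNoetherian.noetherian _) ?_ (IsLocalRing.maximalIdeal_le_jacobson _)
    intro a ha
    obtain ⟨b, rfl⟩ := Ideal.mem_span_singleton'.1 (hqx ha)
    have hb : b ∈ q := (hqp.mem_or_mem ha).resolve_right (hxmin q hq)
    rw [mul_comm]
    exact Submodule.smul_mem_smul hx hb
  rw [hq0] at hqp
  exact IsDomain.of_bot_isPrime R

/-- An ideal that contains the kernel of a surjection onto a regular local ring, and whose quotient
has at least the dimension of that ring, is equal to the kernel. -/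
theorem RingHom.ker_eq_of_ringKrullDim_le {R S : Type*} [CommRing R] [CommRing S]
    [IsRegularLocalRing S] (π : R →+* S) (hπ : Function.Surjective π) {a : Ideal R}
    (hle : RingHom.ker π ≤ a) (hdim : ringKrullDim S ≤ ringKrullDim (R ⧸ a)) :
    a = RingHom.ker π := by
  refine le_antisymm (fun r hr => ?_) hle
  have := IsRegularLocalRing.isDomain S
  by_contra hne
  have hr0 : π r ∈ nonZeroDivisors S := mem_nonZeroDivisors_of_ne_zero hne
  have h1 := ringKrullDim_quotient_succ_le_of_nonZeroDivisor hr0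
  have hker : ∀ s ∈ RingHom.ker π, Ideal.Quotient.mk a s = 0 := fun s hs =>
    Ideal.Quotient.eq_zero_iff_mem.2 (hle hs)
  -- `R ⧸ a` is a quotient of `S / (π r)`, whose dimension is strictly below that of `S`.
  let g : S →+* R ⧸ a := RingHom.liftOfSurjective π hπ ⟨Ideal.Quotient.mk a, hker⟩
  have hg : ∀ s, g (π s) = Ideal.Quotient.mk a s := fun s =>
    RingHom.liftOfRightInverse_comp_apply _ _ _ _ s
  let g' : S ⧸ Ideal.span {π r} →+* R ⧸ a := Ideal.Quotient.lift _ g (by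
    intro s hs
    obtain ⟨c, rfl⟩ := Ideal.mem_span_singleton'.1 hs
    rw [map_mul, hg, Ideal.Quotient.eq_zero_iff_mem.2 hr, mul_zero])
  have hg' : Function.Surjective g' := by
    intro y
    obtain ⟨s, rfl⟩ := Ideal.Quotient.mk_surjective y
    exact ⟨Ideal.Quotient.mk _ (π s), hg s⟩
  have h2 := ringKrullDim_le_of_surjective g' hg'
  have h3 : ringKrullDim S + 1 ≤ ringKrullDim S := by
    refine le_trans ?_ h1
    gcongr
    exact hdim.trans h2
  -- The dimension is a natural number here, so `dim S + 1 ≤ dim S` is absurd.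
  rw [← IsRegularLocalRing.spanFinrank_maximalIdeal (R := S)] at h3
  have h4 : (maximalIdeal S).spanFinrank + 1 ≤ (maximalIdeal S).spanFinrank := by exact_mod_cast h3
  omega

end RegularLocalRing

/-! ### Exterior algebras of finitely generated modules. -/

section ExteriorAlgebraAux

open Set.powersetCard

/-- The top exterior product of a family indexed by `Fin t` is the only exterior product of `t` of
its members in increasing order. -/
theorem ExteriorAlgebra.ιMulti_family_top {R M : Type*} [CommRing R] [AddCommGroup M] [Module R M]
    {t : ℕ} (v : Fin t → M) (s : Set.powersetCard (Fin t) t) :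
    ExteriorAlgebra.ιMulti_family R t v s = ExteriorAlgebra.ιMulti R t v := by
  have h : ofFinEmbEquiv.symm s = RelEmbedding.refl _ := by
    refine DFunLike.coe_injective
      ((StrictMono.range_inj (OrderEmbedding.strictMono _) strictMono_id).1 ?_)
    rw [(Finite.surjective_of_injective (ofFinEmbEquiv.symm s).injective).range_eq]
    exact Set.range_id.symm
  rw [ExteriorAlgebra.ιMulti_family, h]
  rfl

/-- An algebra map from the exterior algebra of a free module of finite rank is injective as soon as
it is injective on the top exterior power. -/
theorem ExteriorAlgebra.injective_of_top {R M B : Type*} [CommRing R] [AddCommGroup M] [Module R M]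
    [Ring B] [Algebra R B] {t : ℕ} (b : Module.Basis (Fin t) R M)
    (f : ExteriorAlgebra R M →ₐ[R] B)
    (hf : ∀ r : R, r • f (ExteriorAlgebra.ιMulti R t b) = 0 → r = 0) :
    Function.Injective f := by
  classical
  rw [injective_iff_map_eq_zero]
  intro z hz
  by_contra hne
  let E := b.ExteriorAlgebra
  have hsupp : (E.repr z).support.Nonempty := by
    rw [Finsupp.support_nonempty_iff]
    simpa using hne
  -- `S` is a smallest monomial of `z`. Any other monomial `T` of `z` is not contained in `S`, so it
  -- meets the complement of `S`; multiplying by `E Sᶜ` leaves only the `S` term, which becomes the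
  -- top product up to sign.
  obtain ⟨S, hS, hmin⟩ := Finset.exists_min_image _ Finset.card hsupp
  have hzE : z = ∑ T ∈ (E.repr z).support, E.repr z T • E T := (E.linearCombination_repr z).symm
  have hmul : ∀ T ∈ (E.repr z).support, T ≠ S → E T * E Sᶜ = 0 := by
    intro T hT hTS
    have hnd : ¬ Disjoint T Sᶜ := by
      rw [disjoint_compl_right_iff]
      intro hle
      exact hTS (Finset.eq_of_subset_of_card_le hle (hmin T hT))
    exact ExteriorAlgebra.basis_mul_of_not_disjoint b (ofCard (s := T) rfl)
      (ofCard (s := Sᶜ) rfl) hnd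
  have hprod : z * E Sᶜ = E.repr z S • (E S * E Sᶜ) := by
    conv_lhs => rw [hzE]
    rw [Finset.sum_mul, Finset.sum_eq_single_of_mem S hS]
    · rw [smul_mul_assoc]
    · intro T hT hTS
      rw [smul_mul_assoc, hmul T hT hTS, smul_zero]
  have hd : Disjoint (ofCard (s := S) rfl).val (ofCard (s := Sᶜ) rfl).val :=
    disjoint_compl_right (a := S)
  have hcard : S.card + Sᶜ.card = t := by simp
  have htop : ∃ u : ℤˣ, E S * E Sᶜ = u • ExteriorAlgebra.ιMulti R t b := by
    refine ⟨Equiv.Perm.sign (permOfDisjoint hd), (ExteriorAlgebra.basis_mul_of_disjoint b _ _ hd).trans ?_⟩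
    congr 1
    have h1 : ((disjUnion hd).val).card = t := (disjUnion hd).2.trans hcard
    rw [← ExteriorAlgebra.ιMulti_family_top b (ofCard h1)]
    exact ExteriorAlgebra.basis_apply_ofCard b h1
  obtain ⟨u, hu⟩ := htop
  have h0 : E.repr z S • f (E S * E Sᶜ) = 0 := by
    rw [← map_smul, ← hprod, map_mul, hz, zero_mul]
  have h1 : E.repr z S • f (ExteriorAlgebra.ιMulti R t b) = 0 := by
    rcases Int.units_eq_one_or u with rfl | rfl
    · simpa [hu] using h0
    · simpa [hu] using h0
  exact (Finsupp.mem_support_iff.1 hS) (hf _ h1)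

/-- Products of generators in increasing order span each exterior power, and `Fin t` has a single
subset with `t` elements. Linear independence plays no role. -/
theorem ExteriorAlgebra.exteriorPower_eq_span_singleton {R M : Type*} [CommRing R]
    [AddCommGroup M] [Module R M] {t : ℕ} {v : Fin t → M}
    (hv : Submodule.span R (Set.range v) = ⊤) :
    ⋀[R]^t M = Submodule.span R {ExteriorAlgebra.ιMulti R t v} := by
  rw [← exteriorPower.ιMulti_family_span_fixedDegree_of_span R hv]
  apply le_antisymm
  · rw [Submodule.span_le]
    rintro _ ⟨s, rfl⟩
    rw [ExteriorAlgebra.ιMulti_family_top]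
    exact Submodule.mem_span_singleton_self _
  · rw [Submodule.span_singleton_le_iff_mem]
    refine Submodule.subset_span ⟨ofCard (s := Finset.univ) (by simp), ?_⟩
    rw [ExteriorAlgebra.ιMulti_family_top]

theorem ExteriorAlgebra.exteriorPower_eq_bot_of_lt {R M : Type*} [CommRing R]
    [AddCommGroup M] [Module R M] {t n : ℕ} {v : Fin t → M}
    (hv : Submodule.span R (Set.range v) = ⊤) (hn : t < n) :
    ⋀[R]^n M = ⊥ := by
  rw [← exteriorPower.ιMulti_family_span_fixedDegree_of_span R hv, Submodule.span_eq_bot]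
  rintro _ ⟨s, rfl⟩
  have h1 := Finset.card_le_univ s.val
  have h2 : s.val.card = n := s.2
  rw [h2, Fintype.card_fin] at h1
  omega

end ExteriorAlgebraAux

/-! ### The even part of a super-ring: Noetherian and local properties. -/

section SuperRingBasics

open DirectSum

variable {A : Type*} [Ring A] (𝒜 : ZMod 2 → AddSubgroup A) [GradedRing 𝒜]

namespace SuperRing

theorem decompose_even_add_odd {x y : A} (hx : x ∈ 𝒜 0) (hy : y ∈ 𝒜 1) :
    (decompose 𝒜 (x + y) 0 : A) = x ∧ (decompose 𝒜 (x + y) 1 : A) = y := by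
  rw [decompose_add, DirectSum.add_apply, DirectSum.add_apply, AddSubgroup.coe_add, AddSubgroup.coe_add,
    decompose_of_mem_same 𝒜 hx, decompose_of_mem_same 𝒜 hy,
    decompose_of_mem_ne 𝒜 hx (by decide), decompose_of_mem_ne 𝒜 hy (by decide)]
  simp

theorem even_mul_even_mem {x y : A} (hx : x ∈ 𝒜 0) (hy : y ∈ 𝒜 0) : x * y ∈ 𝒜 0 := by
  simpa using SetLike.mul_mem_graded hx hy

theorem even_mul_odd_mem {x y : A} (hx : x ∈ 𝒜 0) (hy : y ∈ 𝒜 1) : x * y ∈ 𝒜 1 := by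
  simpa using SetLike.mul_mem_graded hx hy

theorem odd_mul_even_mem {x y : A} (hx : x ∈ 𝒜 1) (hy : y ∈ 𝒜 0) : x * y ∈ 𝒜 1 := by
  simpa using SetLike.mul_mem_graded hx hy

theorem odd_mul_odd_mem {x y : A} (hx : x ∈ 𝒜 1) (hy : y ∈ 𝒜 1) : x * y ∈ 𝒜 0 := by
  have h := SetLike.mul_mem_graded hx hy
  rwa [show (1 : ZMod 2) + 1 = 0 by decide] at h

theorem decompose_mul_eq (a b : A) :
    (decompose 𝒜 (a * b) 0 : A) = decompose 𝒜 a 0 * (decompose 𝒜 b 0 : A) +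
      decompose 𝒜 a 1 * (decompose 𝒜 b 1 : A) ∧
    (decompose 𝒜 (a * b) 1 : A) = decompose 𝒜 a 0 * (decompose 𝒜 b 1 : A) +
      decompose 𝒜 a 1 * (decompose 𝒜 b 0 : A) := by
  have h : a * b = (decompose 𝒜 a 0 * (decompose 𝒜 b 0 : A) +
      decompose 𝒜 a 1 * (decompose 𝒜 b 1 : A)) + (decompose 𝒜 a 0 * (decompose 𝒜 b 1 : A) +
      decompose 𝒜 a 1 * (decompose 𝒜 b 0 : A)) := by
    conv_lhs => rw [eq_even_add_odd 𝒜 a, eq_even_add_odd 𝒜 b]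
    noncomm_ring
  rw [h]
  exact decompose_even_add_odd 𝒜
    (add_mem (even_mul_even_mem 𝒜 (SetLike.coe_mem _) (SetLike.coe_mem _))
      (odd_mul_odd_mem 𝒜 (SetLike.coe_mem _) (SetLike.coe_mem _)))
    (add_mem (even_mul_odd_mem 𝒜 (SetLike.coe_mem _) (SetLike.coe_mem _))
      (odd_mul_even_mem 𝒜 (SetLike.coe_mem _) (SetLike.coe_mem _)))

variable [IsSuperCommutative 𝒜]

/-- A super-commutative ring is an algebra over its even part. -/
instance instAlgebraEven : Algebra (𝒜 0) A where
  smul r a := r * a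
  algebraMap :=
    { toFun := fun r => r
      map_one' := rfl
      map_mul' := fun _ _ => rfl
      map_zero' := rfl
      map_add' := fun _ _ => rfl }
  commutes' r a := even_comm 𝒜 r.2 a
  smul_def' _ _ := rfl

theorem even_smul_def (r : 𝒜 0) (a : A) : r • a = (r : A) * a := rfl

/-- The component of parity `i`, as a module over the even part. -/
def gradedPart (i : ZMod 2) : Submodule (𝒜 0) A where
  carrier := 𝒜 i
  add_mem' := add_mem
  zero_mem' := zero_mem _
  smul_mem' r a ha := by
    change (r : A) * a ∈ 𝒜 i
    simpa using SetLike.mul_mem_graded r.2 ha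

/-- The left ideal generated by a module over the even part. -/
def idealOfSubmodule (M : Submodule (𝒜 0) A) : Ideal A where
  carrier := (⊤ * M : Submodule (𝒜 0) A)
  add_mem' := add_mem
  zero_mem' := zero_mem _
  smul_mem' c a ha := by
    refine Submodule.mul_induction_on
      (C := fun a => c • a ∈ (⊤ * M : Submodule (𝒜 0) A)) ha (fun d _ y hy => ?_)
      (fun a b ha hb => ?_)
    · rw [smul_eq_mul, ← mul_assoc]
      exact Submodule.mul_mem_mul trivial hy
    · rw [smul_add]
      exact add_mem ha hb

theorem mem_idealOfSubmodule {M : Submodule (𝒜 0) A} {a : A} :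
    a ∈ idealOfSubmodule 𝒜 M ↔ a ∈ (⊤ * M : Submodule (𝒜 0) A) := Iff.rfl

theorem idealOfSubmodule_mono {M M' : Submodule (𝒜 0) A} (h : M ≤ M') :
    idealOfSubmodule 𝒜 M ≤ idealOfSubmodule 𝒜 M' := by
  intro a ha
  rw [mem_idealOfSubmodule] at ha ⊢
  have h' : (⊤ * M : Submodule (𝒜 0) A) ≤ ⊤ * M' := mul_le_mul' le_rfl h
  exact h' ha

theorem idealOfSubmodule_isHomogeneous {i : ZMod 2} {M : Submodule (𝒜 0) A}
    (hM : M ≤ gradedPart 𝒜 i) : (idealOfSubmodule 𝒜 M).IsHomogeneous 𝒜 := by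
  intro j a ha
  rw [mem_idealOfSubmodule] at ha ⊢
  induction ha using Submodule.mul_induction_on' with
  | mem_mul_mem c _ y hy =>
    have hyi : y ∈ 𝒜 i := hM hy
    have h := coe_decompose_mul_add_of_right_mem 𝒜 (a := c) (i := j - i) hyi
    rw [sub_add_cancel] at h
    rw [h]
    exact Submodule.mul_mem_mul trivial hy
  | add a _ b _ ha hb =>
    rw [decompose_add, DirectSum.add_apply, AddSubgroup.coe_add]
    exact add_mem ha hb

/-- For `y` of parity `i`, the component of parity `i` of `c * y` is `c₀ * y`. Thus `M` can be
recovered from the super-ideal that it generates. -/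
theorem decompose_mem_of_mem_idealOfSubmodule {i : ZMod 2} {M : Submodule (𝒜 0) A}
    (hM : M ≤ gradedPart 𝒜 i) {a : A} (ha : a ∈ idealOfSubmodule 𝒜 M) :
    (decompose 𝒜 a i : A) ∈ M := by
  rw [mem_idealOfSubmodule] at ha
  induction ha using Submodule.mul_induction_on' with
  | mem_mul_mem c _ y hy =>
    have hyi : y ∈ 𝒜 i := hM hy
    have h := coe_decompose_mul_add_of_right_mem 𝒜 (a := c) (i := 0) hyi
    rw [zero_add] at h
    rw [h]
    exact M.smul_mem (decompose 𝒜 c 0) hy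
  | add a _ b _ ha hb =>
    rw [decompose_add, DirectSum.add_apply, AddSubgroup.coe_add]
    exact add_mem ha hb

/-- Sending a submodule to the super-ideal that it generates is monotone and injective, so the
ascending chain condition descends from super-ideals. -/
theorem isNoetherian_gradedPart [IsNoetherianSuperRing 𝒜] (i : ZMod 2) :
    IsNoetherian (𝒜 0) (gradedPart 𝒜 i) := by
  have := IsNoetherianSuperRing.wellFoundedGT (𝒜 := 𝒜)
  rw [isNoetherian_iff']
  let F : Submodule (𝒜 0) (gradedPart 𝒜 i) → HomogeneousIdeal 𝒜 := fun M =>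
    ⟨idealOfSubmodule 𝒜 (M.map (gradedPart 𝒜 i).subtype),
      idealOfSubmodule_isHomogeneous 𝒜 (Submodule.map_subtype_le _ _)⟩
  have hmem : ∀ M (y : gradedPart 𝒜 i), (y : A) ∈ (F M).toIdeal ↔ y ∈ M := by
    intro M y
    constructor
    · intro h
      have h' := decompose_mem_of_mem_idealOfSubmodule 𝒜 (Submodule.map_subtype_le _ M) h
      rw [decompose_of_mem_same 𝒜 y.2] at h'
      obtain ⟨z, hz, hzy⟩ := h'
      rwa [← Subtype.ext (show (z : A) = y from hzy)]
    · intro h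
      have h' : (1 : A) * (y : A) ∈ (⊤ * M.map (gradedPart 𝒜 i).subtype : Submodule (𝒜 0) A) :=
        Submodule.mul_mem_mul trivial ⟨y, h, rfl⟩
      rw [one_mul] at h'
      exact h'
  have hmono : Monotone F := by
    intro M M' h
    exact idealOfSubmodule_mono 𝒜 (Submodule.map_mono h)
  have hinj : Function.Injective F := by
    intro M M' h
    ext y
    rw [← hmem, h, hmem]
  exact (hmono.strictMono_of_injective hinj).wellFoundedGT

instance isNoetherianRing_even [IsNoetherianSuperRing 𝒜] : IsNoetherianRing (𝒜 0) := by
  have := isNoetherian_gradedPart 𝒜 0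
  let e : gradedPart 𝒜 0 →ₗ[𝒜 0] 𝒜 0 :=
    { toFun := fun y => ⟨y, y.2⟩
      map_add' := fun _ _ => rfl
      map_smul' := fun _ _ => rfl }
  exact isNoetherian_of_surjective (f := e)
    (LinearMap.range_eq_top.2 fun y => ⟨⟨y, y.2⟩, rfl⟩)

/-- Anticommutation gives `(x y)² = 0`. -/
theorem odd_mul_odd_mem_of_isPrime (p : Ideal (𝒜 0)) [p.IsPrime] {x y : A} (hx : x ∈ 𝒜 1)
    (hy : y ∈ 𝒜 1) : (⟨x * y, odd_mul_odd_mem 𝒜 hx hy⟩ : 𝒜 0) ∈ p := by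
  have h : (⟨x * y, odd_mul_odd_mem 𝒜 hx hy⟩ : 𝒜 0) * ⟨x * y, odd_mul_odd_mem 𝒜 hx hy⟩ = 0 := by
    apply Subtype.ext
    change x * y * (x * y) = 0
    rw [mul_assoc, ← mul_assoc y, odd_anticomm 𝒜 hy hx, neg_mul, mul_assoc x y y,
      IsSuperCommutative.odd_mul_self (𝒜 := 𝒜) y hy]
    simp
  have h' : (⟨x * y, odd_mul_odd_mem 𝒜 hx hy⟩ : 𝒜 0) * ⟨x * y, odd_mul_odd_mem 𝒜 hx hy⟩ ∈ p := by
    rw [h]; exact p.zero_mem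
  exact (‹p.IsPrime›.mem_or_mem h').elim id id

/-- The super-ideal `p ⊕ 𝒜 1`, for a prime ideal `p` of the even part. -/
def homogeneousIdealOfPrime (p : Ideal (𝒜 0)) [p.IsPrime] : HomogeneousIdeal 𝒜 where
  carrier := {a | decompose 𝒜 a 0 ∈ p}
  add_mem' {a b} ha hb := by
    change decompose 𝒜 (a + b) 0 ∈ p
    rw [decompose_add, DirectSum.add_apply]
    exact add_mem ha hb
  zero_mem' := by
    change decompose 𝒜 (0 : A) 0 ∈ p
    simp
  smul_mem' c a ha := by
    change decompose 𝒜 (c * a) 0 ∈ p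
    have h : decompose 𝒜 (c * a) 0 = decompose 𝒜 c 0 * decompose 𝒜 a 0 +
        ⟨decompose 𝒜 c 1 * (decompose 𝒜 a 1 : A),
          odd_mul_odd_mem 𝒜 (SetLike.coe_mem _) (SetLike.coe_mem _)⟩ :=
      Subtype.ext (decompose_mul_eq 𝒜 c a).1
    rw [h]
    exact add_mem (p.mul_mem_left _ ha)
      (odd_mul_odd_mem_of_isPrime 𝒜 p (SetLike.coe_mem _) (SetLike.coe_mem _))
  is_homogeneous' j a ha := by
    change decompose 𝒜 ((decompose 𝒜 a j : A)) 0 ∈ p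
    by_cases h : j = 0
    · subst h
      rw [show decompose 𝒜 ((decompose 𝒜 a 0 : A)) 0 = decompose 𝒜 a 0 from
        Subtype.ext (decompose_of_mem_same 𝒜 (SetLike.coe_mem _))]
      exact ha
    · rw [show decompose 𝒜 ((decompose 𝒜 a j : A)) 0 = 0 from
        Subtype.ext (decompose_of_mem_ne 𝒜 (SetLike.coe_mem _) h)]
      exact p.zero_mem

theorem mem_homogeneousIdealOfPrime {p : Ideal (𝒜 0)} [p.IsPrime] {a : A} :
    a ∈ (homogeneousIdealOfPrime 𝒜 p).toIdeal ↔ decompose 𝒜 a 0 ∈ p := Iff.rfl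

/-- The map from the even part to the quotient by a super-ideal. -/
def evenToQuotient (P : HomogeneousIdeal 𝒜) : 𝒜 0 →+* A ⧸ P.toIdeal :=
  (Ideal.Quotient.mk P.toIdeal).comp (algebraMap (𝒜 0) A)

theorem evenToQuotient_apply (P : HomogeneousIdeal 𝒜) (r : 𝒜 0) :
    evenToQuotient 𝒜 P r = Ideal.Quotient.mk P.toIdeal (r : A) := rfl

theorem evenToQuotient_surjective {P : HomogeneousIdeal 𝒜} (h : ∀ y ∈ 𝒜 1, y ∈ P.toIdeal) :
    Function.Surjective (evenToQuotient 𝒜 P) := by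
  intro c
  obtain ⟨a, rfl⟩ := Ideal.Quotient.mk_surjective c
  obtain ⟨x, hx, y, hy, rfl⟩ := exists_even_add_odd 𝒜 a
  refine ⟨⟨x, hx⟩, ?_⟩
  rw [evenToQuotient_apply, map_add, Ideal.Quotient.eq_zero_iff_mem.2 (h y hy), add_zero]

theorem mem_ker_evenToQuotient {P : HomogeneousIdeal 𝒜} {r : 𝒜 0} :
    r ∈ RingHom.ker (evenToQuotient 𝒜 P) ↔ (r : A) ∈ P.toIdeal := by
  rw [RingHom.mem_ker, evenToQuotient_apply, Ideal.Quotient.eq_zero_iff_mem]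

theorem odd_mem_of_isMaximal {P : HomogeneousIdeal 𝒜} (hP : IsMaximalSuperIdeal 𝒜 P) {y : A}
    (hy : y ∈ 𝒜 1) : y ∈ P.toIdeal := by
  let := hP.toField
  have : IsDomain (A ⧸ P.toIdeal) := hP.isDomain
  have h : Ideal.Quotient.mk P.toIdeal y * Ideal.Quotient.mk P.toIdeal y = 0 := by
    rw [← map_mul, IsSuperCommutative.odd_mul_self (𝒜 := 𝒜) y hy, map_zero]
  exact Ideal.Quotient.eq_zero_iff_mem.1 (mul_self_eq_zero.1 h)

theorem isMaximal_iff_isMaximal_ker {P : HomogeneousIdeal 𝒜} (h : ∀ y ∈ 𝒜 1, y ∈ P.toIdeal) :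
    IsMaximalSuperIdeal 𝒜 P ↔ (RingHom.ker (evenToQuotient 𝒜 P)).IsMaximal := by
  rw [Ideal.Quotient.maximal_ideal_iff_isField_quotient]
  let e := RingHom.quotientKerEquivOfSurjective (evenToQuotient_surjective 𝒜 h)
  exact ⟨fun hP => e.toMulEquiv.isField hP, fun hP => e.symm.toMulEquiv.isField hP⟩

theorem ker_homogeneousIdealOfPrime (p : Ideal (𝒜 0)) [p.IsPrime] :
    RingHom.ker (evenToQuotient 𝒜 (homogeneousIdealOfPrime 𝒜 p)) = p := by
  ext r
  rw [mem_ker_evenToQuotient, mem_homogeneousIdealOfPrime,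
    show decompose 𝒜 (r : A) 0 = r from Subtype.ext (decompose_of_mem_same 𝒜 r.2)]

theorem odd_mem_homogeneousIdealOfPrime (p : Ideal (𝒜 0)) [p.IsPrime] {y : A} (hy : y ∈ 𝒜 1) :
    y ∈ (homogeneousIdealOfPrime 𝒜 p).toIdeal := by
  rw [mem_homogeneousIdealOfPrime, show decompose 𝒜 y 0 = 0 from
    Subtype.ext (decompose_of_mem_ne 𝒜 hy (by decide))]
  exact p.zero_mem

variable [IsLocalSuperRing 𝒜]

theorem isMaximal_maximalSuperIdeal : IsMaximalSuperIdeal 𝒜 (maximalSuperIdeal 𝒜) :=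
  (IsLocalSuperRing.existsUnique_maximal (𝒜 := 𝒜)).choose_spec.1

theorem eq_maximalSuperIdeal {P : HomogeneousIdeal 𝒜} (hP : IsMaximalSuperIdeal 𝒜 P) :
    P = maximalSuperIdeal 𝒜 :=
  (IsLocalSuperRing.existsUnique_maximal (𝒜 := 𝒜)).choose_spec.2 P hP

theorem odd_mem_maximalSuperIdeal {y : A} (hy : y ∈ 𝒜 1) : y ∈ (maximalSuperIdeal 𝒜).toIdeal :=
  odd_mem_of_isMaximal 𝒜 (isMaximal_maximalSuperIdeal 𝒜) hy

/-- A field has no nonzero nilpotents, so a maximal super-ideal contains all odd elements and is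
determined by its even part; `n ↦ n ⊕ 𝒜 1` carries maximal ideals of `𝒜 0` to maximal super-ideals.
-/
instance isLocalRing_even : IsLocalRing (𝒜 0) := by
  refine IsLocalRing.of_unique_max_ideal ⟨RingHom.ker (evenToQuotient 𝒜 (maximalSuperIdeal 𝒜)),
    (isMaximal_iff_isMaximal_ker 𝒜 fun y hy => odd_mem_maximalSuperIdeal 𝒜 hy).1
      (isMaximal_maximalSuperIdeal 𝒜), fun n hn => ?_⟩
  have hn' : n.IsMaximal := hn
  have hnp : n.IsPrime := hn'.isPrime
  have h := eq_maximalSuperIdeal 𝒜 ((isMaximal_iff_isMaximal_ker 𝒜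
    fun y hy => odd_mem_homogeneousIdealOfPrime 𝒜 n hy).2
      (by rwa [ker_homogeneousIdealOfPrime]))
  rw [← h, ker_homogeneousIdealOfPrime]

theorem maximalIdeal_even_eq_ker :
    IsLocalRing.maximalIdeal (𝒜 0) = RingHom.ker (evenToQuotient 𝒜 (maximalSuperIdeal 𝒜)) := by
  have := (isMaximal_iff_isMaximal_ker 𝒜 fun y hy => odd_mem_maximalSuperIdeal 𝒜 hy).1
      (isMaximal_maximalSuperIdeal 𝒜)
  exact (IsLocalRing.eq_maximalIdeal this).symm

theorem mem_maximalIdeal_even {r : 𝒜 0} :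
    r ∈ IsLocalRing.maximalIdeal (𝒜 0) ↔ (r : A) ∈ (maximalSuperIdeal 𝒜).toIdeal := by
  rw [maximalIdeal_even_eq_ker, mem_ker_evenToQuotient]

end SuperRing

end SuperRingBasics

/-! ### The quotient by the odd ideal, and the powers of that ideal. -/

theorem ringKrullDim_eq_of_surjective_of_ker_le {R S : Type*} [CommRing R] [CommRing S]
    (f : R →+* S) (hf : Function.Surjective f)
    (h : ∀ p : Ideal R, p.IsPrime → RingHom.ker f ≤ p) : ringKrullDim R = ringKrullDim S := by
  rw [← ringKrullDim_eq_of_ringEquiv (RingHom.quotientKerEquivOfSurjective hf),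
    ringKrullDim_quotient,
    show PrimeSpectrum.zeroLocus (R := R) (RingHom.ker f : Set R) = Set.univ from
      Set.eq_univ_of_forall fun p => h p.asIdeal p.2]
  exact (Order.krullDim_eq_of_orderIso OrderIso.Set.univ).symm

section OddIdeal

open DirectSum

variable {A : Type*} [Ring A] (𝒜 : ZMod 2 → AddSubgroup A) [GradedRing 𝒜] [IsSuperCommutative 𝒜]

namespace SuperRing

/-- The map from the even part to the quotient by the ideal generated by the odd elements. -/
def evenToBar : 𝒜 0 →+* A ⧸ oddIdeal 𝒜 :=
  (Ideal.Quotient.mk (oddIdeal 𝒜)).comp (algebraMap (𝒜 0) A)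

theorem evenToBar_apply (r : 𝒜 0) :
    evenToBar 𝒜 r = Ideal.Quotient.mk (oddIdeal 𝒜) (r : A) := rfl

theorem evenToBar_surjective : Function.Surjective (evenToBar 𝒜) := by
  intro c
  obtain ⟨x, hx, rfl⟩ := exists_even_mk_eq 𝒜 c
  exact ⟨⟨x, hx⟩, rfl⟩

theorem mem_ker_evenToBar {r : 𝒜 0} :
    r ∈ RingHom.ker (evenToBar 𝒜) ↔ (r : A) ∈ oddIdeal 𝒜 := by
  rw [RingHom.mem_ker, evenToBar_apply]
  exact Ideal.Quotient.eq_zero_iff_mem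

/-- The super-ideal `p ⊕ 𝒜 1` contains every odd element, hence the whole odd ideal. This makes the
spectra of `𝒜 0` and of the quotient coincide. -/
theorem ker_evenToBar_le (p : Ideal (𝒜 0)) (hp : p.IsPrime) : RingHom.ker (evenToBar 𝒜) ≤ p := by
  intro r hr
  rw [mem_ker_evenToBar] at hr
  have h : oddIdeal 𝒜 ≤ (homogeneousIdealOfPrime 𝒜 p).toIdeal :=
    Ideal.span_le.2 fun y hy => odd_mem_homogeneousIdealOfPrime 𝒜 p hy
  have h' := h hr
  rwa [mem_homogeneousIdealOfPrime,
    show decompose 𝒜 (r : A) 0 = r from Subtype.ext (decompose_of_mem_same 𝒜 r.2)] at h'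

theorem ringKrullDim_bar : ringKrullDim (𝒜 0) = ringKrullDim (A ⧸ oddIdeal 𝒜) :=
  ringKrullDim_eq_of_surjective_of_ker_le _ (evenToBar_surjective 𝒜) (ker_evenToBar_le 𝒜)

instance isNoetherianRing_bar [IsNoetherianSuperRing 𝒜] : IsNoetherianRing (A ⧸ oddIdeal 𝒜) :=
  isNoetherianRing_of_surjective _ _ _ (evenToBar_surjective 𝒜)

instance isLocalRing_bar [IsLocalSuperRing 𝒜] : IsLocalRing (A ⧸ oddIdeal 𝒜) := by
  have : Nontrivial (A ⧸ oddIdeal 𝒜) := by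
    refine ⟨1, 0, fun h => ?_⟩
    rw [← map_one (evenToBar 𝒜), ← RingHom.mem_ker] at h
    exact (IsLocalRing.maximalIdeal.isMaximal (𝒜 0)).ne_top ((Ideal.eq_top_iff_one _).2
      (ker_evenToBar_le 𝒜 _ inferInstance h))
  exact IsLocalRing.of_surjective' _ (evenToBar_surjective 𝒜)

/-- An odd element moves past even elements freely and past odd ones with a sign. This collects all
odd factors on the right in powers of the odd ideal. -/
theorem gradedPart_one_mul_top_le :
    gradedPart 𝒜 1 * ⊤ ≤ (⊤ * gradedPart 𝒜 1 : Submodule (𝒜 0) A) := by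
  rw [Submodule.mul_le]
  intro y hy c _
  obtain ⟨u, hu, v, hv, rfl⟩ := exists_even_add_odd 𝒜 c
  rw [mul_add, ← even_comm 𝒜 hu, odd_anticomm 𝒜 hy hv, ← neg_mul]
  exact add_mem (Submodule.mul_mem_mul trivial hy) (Submodule.mul_mem_mul trivial hy)

theorem gradedPart_one_pow_mul_top_le (n : ℕ) :
    gradedPart 𝒜 1 ^ n * ⊤ ≤ (⊤ * gradedPart 𝒜 1 ^ n : Submodule (𝒜 0) A) := by
  induction n with
  | zero => simp
  | succ n ih =>
    calc gradedPart 𝒜 1 ^ (n + 1) * ⊤ = gradedPart 𝒜 1 ^ n * (gradedPart 𝒜 1 * ⊤) := by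
          rw [pow_succ, mul_assoc]
      _ ≤ gradedPart 𝒜 1 ^ n * (⊤ * gradedPart 𝒜 1) :=
          mul_le_mul' le_rfl (gradedPart_one_mul_top_le 𝒜)
      _ = gradedPart 𝒜 1 ^ n * ⊤ * gradedPart 𝒜 1 := by rw [mul_assoc]
      _ ≤ ⊤ * gradedPart 𝒜 1 ^ n * gradedPart 𝒜 1 := mul_le_mul' ih le_rfl
      _ = ⊤ * gradedPart 𝒜 1 ^ (n + 1) := by rw [mul_assoc, ← pow_succ]

theorem mem_top_mul_of_mem_oddIdeal {a : A} (ha : a ∈ oddIdeal 𝒜) :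
    a ∈ (⊤ * gradedPart 𝒜 1 : Submodule (𝒜 0) A) := by
  have h : oddIdeal 𝒜 ≤ idealOfSubmodule 𝒜 (gradedPart 𝒜 1) :=
    Ideal.span_le.2 fun y hy => by
      have h' : (1 : A) * y ∈ (⊤ * gradedPart 𝒜 1 : Submodule (𝒜 0) A) :=
        Submodule.mul_mem_mul trivial hy
      rwa [one_mul] at h'
  exact h ha

theorem mem_top_mul_pow_of_mem_oddIdeal_pow (n : ℕ) {a : A} (ha : a ∈ oddIdeal 𝒜 ^ n) :
    a ∈ (⊤ * gradedPart 𝒜 1 ^ n : Submodule (𝒜 0) A) := by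
  induction n generalizing a with
  | zero => simp
  | succ n ih =>
    rw [Submodule.pow_succ] at ha
    induction ha using Submodule.smul_induction_on' with
    | smul b hb c hc =>
      have h := Submodule.mul_mem_mul (ih hb) (mem_top_mul_of_mem_oddIdeal 𝒜 hc)
      have hle : (⊤ * gradedPart 𝒜 1 ^ n) * (⊤ * gradedPart 𝒜 1) ≤
          (⊤ * gradedPart 𝒜 1 ^ (n + 1) : Submodule (𝒜 0) A) :=
        calc (⊤ * gradedPart 𝒜 1 ^ n) * (⊤ * gradedPart 𝒜 1)
            = ⊤ * (gradedPart 𝒜 1 ^ n * ⊤) * gradedPart 𝒜 1 := by simp only [mul_assoc]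
          _ ≤ ⊤ * (⊤ * gradedPart 𝒜 1 ^ n) * gradedPart 𝒜 1 :=
            mul_le_mul' (mul_le_mul' le_rfl
              (gradedPart_one_pow_mul_top_le 𝒜 n)) le_rfl
          _ = (⊤ * ⊤) * gradedPart 𝒜 1 ^ (n + 1) := by rw [pow_succ]; simp only [mul_assoc]
          _ ≤ ⊤ * gradedPart 𝒜 1 ^ (n + 1) := mul_le_mul' le_top le_rfl
      exact hle h
    | add b _ c _ hb hc => exact add_mem hb hc

/-- The algebra map from the exterior algebra of the odd part, over the even part. -/
noncomputable def exteriorToSelf : ExteriorAlgebra (𝒜 0) (gradedPart 𝒜 1) →ₐ[𝒜 0] A :=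
  ExteriorAlgebra.lift (𝒜 0) ⟨(gradedPart 𝒜 1).subtype,
    fun y => IsSuperCommutative.odd_mul_self (𝒜 := 𝒜) (y : A) y.2⟩

theorem exteriorToSelf_ι (y : gradedPart 𝒜 1) :
    exteriorToSelf 𝒜 (ExteriorAlgebra.ι (𝒜 0) y) = (y : A) :=
  ExteriorAlgebra.lift_ι_apply (𝒜 0) _ _ y

theorem exteriorToSelf_ιMulti {n : ℕ} (y : Fin n → gradedPart 𝒜 1) :
    exteriorToSelf 𝒜 (ExteriorAlgebra.ιMulti (𝒜 0) n y) =
      (List.ofFn fun i => (y i : A)).prod := by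
  rw [ExteriorAlgebra.ιMulti_apply, map_list_prod, List.map_ofFn]
  congr 2
  funext i
  exact exteriorToSelf_ι 𝒜 (y i)

/-- Both sides are the `n`-th power of the image of the degree one part under an algebra map. Facts
on exterior powers thereby become facts on products of odd elements. -/
theorem gradedPart_one_pow_eq (n : ℕ) :
    gradedPart 𝒜 1 ^ n =
      (⋀[𝒜 0]^n (gradedPart 𝒜 1)).map (exteriorToSelf 𝒜).toLinearMap := by
  rw [ExteriorAlgebra.exteriorPower, Submodule.map_pow]
  congr 1
  rw [← LinearMap.range_comp]
  have h : (exteriorToSelf 𝒜).toLinearMap ∘ₗ ExteriorAlgebra.ι (𝒜 0) =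
      (gradedPart 𝒜 1).subtype := by
    ext y
    exact exteriorToSelf_ι 𝒜 y
  rw [h, Submodule.range_subtype]

theorem prod_mem_gradedPart_one_pow {n : ℕ} (y : Fin n → 𝒜 1) :
    (List.ofFn fun i => (y i : A)).prod ∈ gradedPart 𝒜 1 ^ n := by
  rw [gradedPart_one_pow_eq]
  exact ⟨_, ExteriorAlgebra.ιMulti_range (𝒜 0) n ⟨fun i => ⟨y i, (y i).2⟩, rfl⟩,
    exteriorToSelf_ιMulti 𝒜 fun i => ⟨y i, (y i).2⟩⟩

theorem gradedPart_one_pow_eq_span {t : ℕ} {x : Fin t → gradedPart 𝒜 1}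
    (hx : Submodule.span (𝒜 0) (Set.range x) = ⊤) :
    gradedPart 𝒜 1 ^ t = Submodule.span (𝒜 0) {(List.ofFn fun i => (x i : A)).prod} := by
  rw [gradedPart_one_pow_eq, ExteriorAlgebra.exteriorPower_eq_span_singleton hx,
    Submodule.map_span, Set.image_singleton]
  congr 2
  exact exteriorToSelf_ιMulti 𝒜 x

theorem gradedPart_one_pow_eq_bot {t : ℕ} {x : Fin t → gradedPart 𝒜 1}
    (hx : Submodule.span (𝒜 0) (Set.range x) = ⊤) {n : ℕ} (hn : t < n) : gradedPart 𝒜 1 ^ n = ⊥ := by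
  rw [gradedPart_one_pow_eq, ExteriorAlgebra.exteriorPower_eq_bot_of_lt hx hn, Submodule.map_bot]

/-- Because of this vanishing, a relation on the top product in the graded ring is a genuine
annihilation in `A`. -/
theorem oddIdeal_pow_eq_bot {t : ℕ} {x : Fin t → gradedPart 𝒜 1}
    (hx : Submodule.span (𝒜 0) (Set.range x) = ⊤) : oddIdeal 𝒜 ^ (t + 1) = ⊥ := by
  rw [eq_bot_iff]
  intro a ha
  have h := mem_top_mul_pow_of_mem_oddIdeal_pow 𝒜 (t + 1) ha
  rwa [gradedPart_one_pow_eq_bot 𝒜 hx (Nat.lt_succ_self t), Submodule.mul_bot] at h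

end SuperRing

end OddIdeal

/-! ### The map from the exterior algebra to the associated graded ring. -/

section ExteriorToGr

open DirectSum

variable {A : Type*} [Ring A] (𝒜 : ZMod 2 → AddSubgroup A) [GradedRing 𝒜] [IsSuperCommutative 𝒜]

namespace SuperRing

theorem mem_oddIdeal_pow_one {y : A} (hy : y ∈ 𝒜 1) : y ∈ oddIdeal 𝒜 ^ 1 := by
  rw [Submodule.pow_one]
  exact Ideal.subset_span hy

/-- The class of an odd element in `I / I ^ 2`, for `I` the ideal generated by the odd elements. -/
def oddClass : gradedPart 𝒜 1 →ₛₗ[evenToBar 𝒜] GrPiece (oddIdeal 𝒜) 1 where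
  toFun y := GrPiece.mk (oddIdeal 𝒜) 1 ⟨y, mem_oddIdeal_pow_one 𝒜 y.2⟩
  map_add' _ _ := rfl
  map_smul' _ _ := rfl

theorem oddClass_surjective : Function.Surjective (oddClass 𝒜) := by
  intro v
  obtain ⟨x, rfl⟩ := GrPiece.mk_surjective 1 v
  have hx : (x : A) ∈ oddIdeal 𝒜 := (Submodule.pow_one (oddIdeal 𝒜)).le x.2
  obtain ⟨y, hy, h⟩ := exists_odd_sub_mem 𝒜 hx
  exact ⟨⟨y, hy⟩, (GrPiece.mk_eq_mk_iff.2 h).symm⟩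

theorem oddClass_eq_zero_iff {y : gradedPart 𝒜 1} :
    oddClass 𝒜 y = 0 ↔ (y : A) ∈ oddIdeal 𝒜 ^ 2 := by
  have h : oddClass 𝒜 y = 0 ↔ oddClass 𝒜 y = GrPiece.mk (oddIdeal 𝒜) 1 0 := Iff.rfl
  rw [h, oddClass]
  refine GrPiece.mk_eq_mk_iff.trans ?_
  simp

theorem exteriorToGr_ι (v : GrPiece (oddIdeal 𝒜) 1) :
    exteriorToGr 𝒜 (ExteriorAlgebra.ι (A ⧸ oddIdeal 𝒜) v) =
      DirectSum.of (GrPiece (oddIdeal 𝒜)) 1 v :=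
  ExteriorAlgebra.lift_ι_apply _ _ _ v

/-- Since `I ^ (n + 1) = I ^ n * I`, the graded ring is generated in degree one over its degree zero
component. -/
theorem exteriorToGr_surjective : Function.Surjective (exteriorToGr 𝒜) := by
  have key : ∀ (n : ℕ) (a : A) (ha : a ∈ oddIdeal 𝒜 ^ n),
      DirectSum.of (GrPiece (oddIdeal 𝒜)) n (GrPiece.mk (oddIdeal 𝒜) n ⟨a, ha⟩) ∈
        (exteriorToGr 𝒜).range := by
    intro n
    induction n with
    | zero =>
      intro a ha
      exact (exteriorToGr 𝒜).range.algebraMap_mem (Ideal.Quotient.mk (oddIdeal 𝒜) a)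
    | succ n ih =>
      intro a ha
      have ha' := ha
      rw [Submodule.pow_succ] at ha'
      induction ha' using Submodule.smul_induction_on' with
      | smul b hb c hc =>
        have hc' : c ∈ oddIdeal 𝒜 ^ 1 := by rwa [Submodule.pow_one]
        have h := mul_mem (ih b hb) (show DirectSum.of (GrPiece (oddIdeal 𝒜)) 1
          (GrPiece.mk (oddIdeal 𝒜) 1 ⟨c, hc'⟩) ∈ (exteriorToGr 𝒜).range from
          ⟨_, exteriorToGr_ι 𝒜 _⟩)
        rw [DirectSum.of_mul_of] at h
        exact h
      | add b hb c hc hb' hc' =>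
        rw [smul_eq_mul, ← Submodule.pow_succ] at hb hc
        have h := add_mem (hb' hb) (hc' hc)
        rw [← map_add] at h
        exact h
  intro z
  rw [← AlgHom.mem_range]
  induction z using DirectSum.induction_on with
  | zero => exact zero_mem _
  | of n v =>
    obtain ⟨⟨a, ha⟩, rfl⟩ := GrPiece.mk_surjective n v
    exact key n a ha
  | add v w hv hw => exact add_mem hv hw

theorem prod_mem_oddIdeal_pow {n : ℕ} (y : Fin n → gradedPart 𝒜 1) :
    (List.ofFn fun i => (y i : A)).prod ∈ oddIdeal 𝒜 ^ n := by
  induction n with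
  | zero => simp [Submodule.pow_zero, Ideal.one_eq_top]
  | succ n ih =>
    rw [List.ofFn_succ', List.concat_eq_append, List.prod_append, List.prod_singleton]
    exact GrPiece.mul_mem_pow (ih fun i => y i.castSucc) (mem_oddIdeal_pow_one 𝒜 (y (Fin.last n)).2)

theorem exteriorToGr_ιMulti {n : ℕ} (y : Fin n → gradedPart 𝒜 1) :
    exteriorToGr 𝒜 (ExteriorAlgebra.ιMulti (A ⧸ oddIdeal 𝒜) n fun i => oddClass 𝒜 (y i)) =
      DirectSum.of (GrPiece (oddIdeal 𝒜)) n (GrPiece.mk (oddIdeal 𝒜) n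
        ⟨(List.ofFn fun i => (y i : A)).prod, prod_mem_oddIdeal_pow 𝒜 y⟩) := by
  rw [ExteriorAlgebra.ιMulti_apply, map_list_prod, List.map_ofFn]
  have h : (exteriorToGr 𝒜 ∘ fun i => ExteriorAlgebra.ι (A ⧸ oddIdeal 𝒜) (oddClass 𝒜 (y i))) =
      fun i => DirectSum.of (GrPiece (oddIdeal 𝒜)) 1 (oddClass 𝒜 (y i)) :=
    funext fun i => exteriorToGr_ι 𝒜 _
  rw [h]
  clear h
  induction n with
  | zero => rfl
  | succ n ih =>
    rw [List.ofFn_succ', List.concat_eq_append, List.prod_append, List.prod_singleton,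
      ih fun i => y i.castSucc, oddClass, DirectSum.of_mul_of]
    refine congrArg (fun v => DirectSum.of (GrPiece (oddIdeal 𝒜)) (n + 1) (GrPiece.mk _ _ v))
      (Subtype.ext ?_)
    change (List.ofFn fun i => (y i.castSucc : A)).prod * (y (Fin.last n) : A) =
      (List.ofFn fun i => (y i : A)).prod
    rw [List.ofFn_succ', List.concat_eq_append, List.prod_append, List.prod_singleton]

/-- The top exterior product of odd classes is annihilated by `r` if and only if `r` annihilates
the product of the odd elements. -/
theorem smul_exteriorToGr_ιMulti_eq_zero_iff {n : ℕ} (y : Fin n → gradedPart 𝒜 1) (r : 𝒜 0) :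
    evenToBar 𝒜 r • exteriorToGr 𝒜
        (ExteriorAlgebra.ιMulti (A ⧸ oddIdeal 𝒜) n fun i => oddClass 𝒜 (y i)) = 0 ↔
      (r : A) * (List.ofFn fun i => (y i : A)).prod ∈ oddIdeal 𝒜 ^ (n + 1) := by
  rw [exteriorToGr_ιMulti, ← DirectSum.lof_eq_of (A ⧸ oddIdeal 𝒜), ← map_smul,
    DirectSum.lof_eq_of, map_eq_zero_iff _ (DirectSum.of_injective n)]
  have h : evenToBar 𝒜 r • GrPiece.mk (oddIdeal 𝒜) n
      ⟨(List.ofFn fun i => (y i : A)).prod, prod_mem_oddIdeal_pow 𝒜 y⟩ =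
      GrPiece.mk (oddIdeal 𝒜) n ((r : A) •
        ⟨(List.ofFn fun i => (y i : A)).prod, prod_mem_oddIdeal_pow 𝒜 y⟩) := rfl
  rw [h]
  refine (GrPiece.mk_eq_mk_iff (y := 0)).trans ?_
  simp

end SuperRing

end ExteriorToGr

/-- Two quotients of a module have the same rank if they are quotients by the same submodule, and
are considered over quotients of the base ring by the same ideal. -/
theorem Module.finrank_eq_of_surjective_of_ker_eq {R K K' N V W : Type*} [Ring R] [Ring K]
    [Ring K'] [AddCommGroup N] [AddCommGroup V] [AddCommGroup W] [Module R N] [Module K V]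
    [Module K' W] {φ : R →+* K} {ψ : R →+* K'} (hφ : Function.Surjective φ)
    (hψ : Function.Surjective ψ) (hφψ : ∀ r, φ r = 0 ↔ ψ r = 0) (f : N →ₛₗ[φ] V)
    (g : N →ₛₗ[ψ] W) (hf : Function.Surjective f) (hg : Function.Surjective g)
    (hfg : ∀ n, f n = 0 ↔ g n = 0) : Module.finrank K V = Module.finrank K' W := by
  have hφψ' : ∀ r s, φ r = φ s ↔ ψ r = ψ s := fun r s => by
    rw [← sub_eq_zero, ← map_sub, hφψ, map_sub, sub_eq_zero]
  have hfg' : ∀ r s, f r = f s ↔ g r = g s := fun r s => by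
    rw [← sub_eq_zero, ← map_sub, hfg, map_sub, sub_eq_zero]
  -- Both comparison maps are defined through arbitrary preimages; equality of the kernels makes
  -- them independent of that choice and bijective.
  let i : K → K' := fun k => ψ (Function.surjInv hφ k)
  have hi : ∀ r, i (φ r) = ψ r := fun r => (hφψ' _ _).1 (Function.surjInv_eq hφ _)
  let j₀ : V → W := fun v => g (Function.surjInv hf v)
  have hj : ∀ n, j₀ (f n) = g n := fun n => (hfg' _ _).1 (Function.surjInv_eq hf _)
  have hib : Function.Bijective i := by
    refine ⟨fun a b h => ?_, fun c => ?_⟩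
    · obtain ⟨a, rfl⟩ := hφ a
      obtain ⟨b, rfl⟩ := hφ b
      rw [hi, hi] at h
      exact (hφψ' _ _).2 h
    · obtain ⟨r, rfl⟩ := hψ c
      exact ⟨φ r, hi r⟩
  have hjb : Function.Bijective j₀ := by
    refine ⟨fun a b h => ?_, fun c => ?_⟩
    · obtain ⟨a, rfl⟩ := hf a
      obtain ⟨b, rfl⟩ := hf b
      rw [hj, hj] at h
      exact (hfg' _ _).2 h
    · obtain ⟨r, rfl⟩ := hg c
      exact ⟨f r, hj r⟩
  let j : V ≃+ W := AddEquiv.mk' (Equiv.ofBijective j₀ hjb) (by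
    intro a b
    obtain ⟨a, rfl⟩ := hf a
    obtain ⟨b, rfl⟩ := hf b
    change j₀ (f a + f b) = j₀ (f a) + j₀ (f b)
    rw [← map_add, hj, hj, hj, map_add])
  have h := lift_rank_eq_of_equiv_equiv i j hib (by
    intro k v
    obtain ⟨r, rfl⟩ := hφ k
    obtain ⟨n, rfl⟩ := hf v
    change j₀ (φ r • f n) = i (φ r) • j₀ (f n)
    rw [← LinearMap.map_smulₛₗ, hj, hj, hi, LinearMap.map_smulₛₗ])
  simpa [Module.finrank] using congrArg Cardinal.toNat h

/-! ### The two components of `𝔪 / 𝔪 ^ 2`. -/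

section Cotangent

open DirectSum IsLocalRing

variable {A : Type*} [Ring A] (𝒜 : ZMod 2 → AddSubgroup A) [GradedRing 𝒜] [IsSuperCommutative 𝒜]
  [IsLocalSuperRing 𝒜]

namespace SuperRing

theorem mul_mem_sq {P : HomogeneousIdeal 𝒜} {a b : A} (ha : a ∈ P.toIdeal) (hb : b ∈ P.toIdeal) :
    a * b ∈ P.toIdeal ^ 2 :=
  GrPiece.mul_mem_pow (m := 1) (n := 1) (by rwa [Submodule.pow_one]) (by rwa [Submodule.pow_one])

/-- The class of an odd element in `𝔪 / 𝔪 ^ 2`. -/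
noncomputable def oddCotangent : gradedPart 𝒜 1 →ₛₗ[evenToQuotient 𝒜 (maximalSuperIdeal 𝒜)]
    GrPiece (maximalSuperIdeal 𝒜).toIdeal 1 where
  toFun y := GrPiece.mk _ 1 ⟨y, by
    rw [Submodule.pow_one]; exact odd_mem_maximalSuperIdeal 𝒜 y.2⟩
  map_add' _ _ := rfl
  map_smul' _ _ := rfl

/-- The class in `𝔪 / 𝔪 ^ 2` of an element of the maximal ideal of the even part. -/
noncomputable def evenCotangent : maximalIdeal (𝒜 0) →ₛₗ[evenToQuotient 𝒜 (maximalSuperIdeal 𝒜)]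
    GrPiece (maximalSuperIdeal 𝒜).toIdeal 1 where
  toFun y := GrPiece.mk _ 1 ⟨((y : 𝒜 0) : A), by
    rw [Submodule.pow_one]; exact (mem_maximalIdeal_even 𝒜).1 y.2⟩
  map_add' _ _ := rfl
  map_smul' _ _ := rfl

theorem oddCotangent_eq_zero_iff {y : gradedPart 𝒜 1} :
    oddCotangent 𝒜 y = 0 ↔ (y : A) ∈ (maximalSuperIdeal 𝒜).toIdeal ^ 2 := by
  have h : oddCotangent 𝒜 y = 0 ↔ oddCotangent 𝒜 y = GrPiece.mk _ 1 0 := Iff.rfl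
  rw [h, oddCotangent]
  refine GrPiece.mk_eq_mk_iff.trans ?_
  simp

theorem evenCotangent_eq_zero_iff {y : maximalIdeal (𝒜 0)} :
    evenCotangent 𝒜 y = 0 ↔ ((y : 𝒜 0) : A) ∈ (maximalSuperIdeal 𝒜).toIdeal ^ 2 := by
  have h : evenCotangent 𝒜 y = 0 ↔ evenCotangent 𝒜 y = GrPiece.mk _ 1 0 := Iff.rfl
  rw [h, evenCotangent]
  refine GrPiece.mk_eq_mk_iff.trans ?_
  simp

theorem evenToQuotient_maximal_surjective :
    Function.Surjective (evenToQuotient 𝒜 (maximalSuperIdeal 𝒜)) :=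
  evenToQuotient_surjective 𝒜 fun _ hy => odd_mem_maximalSuperIdeal 𝒜 hy

instance ringHomSurjective_evenToQuotient :
    RingHomSurjective (evenToQuotient 𝒜 (maximalSuperIdeal 𝒜)) :=
  ⟨evenToQuotient_maximal_surjective 𝒜⟩

theorem cotangentComponent_one :
    cotangentComponent 𝒜 (maximalSuperIdeal 𝒜) 1 = LinearMap.range (oddCotangent 𝒜) := by
  rw [cotangentComponent, ← Submodule.span_eq (LinearMap.range (oddCotangent 𝒜))]
  congr 1
  ext v
  constructor
  · rintro ⟨x, hx, rfl⟩
    exact ⟨⟨x, hx⟩, rfl⟩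
  · rintro ⟨y, rfl⟩
    exact ⟨⟨y, by rw [Submodule.pow_one]; exact odd_mem_maximalSuperIdeal 𝒜 y.2⟩, y.2, rfl⟩

theorem cotangentComponent_zero :
    cotangentComponent 𝒜 (maximalSuperIdeal 𝒜) 0 = LinearMap.range (evenCotangent 𝒜) := by
  rw [cotangentComponent, ← Submodule.span_eq (LinearMap.range (evenCotangent 𝒜))]
  congr 1
  ext v
  constructor
  · rintro ⟨x, hx, rfl⟩
    refine ⟨⟨⟨x, hx⟩, (mem_maximalIdeal_even 𝒜).2 ?_⟩, rfl⟩
    exact (Submodule.pow_one (maximalSuperIdeal 𝒜).toIdeal).le x.2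
  · rintro ⟨y, rfl⟩
    exact ⟨_, (y : 𝒜 0).2, rfl⟩

theorem map_evenToBar_maximalIdeal :
    (maximalIdeal (𝒜 0)).map (evenToBar 𝒜) = maximalIdeal (A ⧸ oddIdeal 𝒜) :=
  IsLocalRing.map_maximalIdeal_of_surjective _ (evenToBar_surjective 𝒜)

theorem evenToBar_mem_maximalIdeal_iff {r : 𝒜 0} :
    evenToBar 𝒜 r ∈ maximalIdeal (A ⧸ oddIdeal 𝒜) ↔ r ∈ maximalIdeal (𝒜 0) := by
  have h := Ideal.comap_isMaximal_of_surjective (evenToBar 𝒜) (evenToBar_surjective 𝒜)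
    (K := maximalIdeal (A ⧸ oddIdeal 𝒜))
  rw [← IsLocalRing.eq_maximalIdeal h, Ideal.mem_comap]

/-- For `b, c ∈ 𝔪`, the odd part of `b c` is `b₀c₁ + b₁c₀`, and its even part is `b₀c₀ + b₁c₁`,
whose second term dies modulo the odd ideal. -/
theorem decompose_of_mem_sq {a : A} (ha : a ∈ (maximalSuperIdeal 𝒜).toIdeal ^ 2) :
    (decompose 𝒜 a 1 : A) ∈ maximalIdeal (𝒜 0) • gradedPart 𝒜 1 ∧
      evenToBar 𝒜 (decompose 𝒜 a 0) ∈ maximalIdeal (A ⧸ oddIdeal 𝒜) ^ 2 := by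
  rw [Submodule.pow_succ, Submodule.pow_one] at ha
  induction ha using Submodule.smul_induction_on' with
  | smul b hb c hc =>
    have hb0 : decompose 𝒜 b 0 ∈ maximalIdeal (𝒜 0) :=
      (mem_maximalIdeal_even 𝒜).2 ((maximalSuperIdeal 𝒜).isHomogeneous 0 hb)
    have hc0 : decompose 𝒜 c 0 ∈ maximalIdeal (𝒜 0) :=
      (mem_maximalIdeal_even 𝒜).2 ((maximalSuperIdeal 𝒜).isHomogeneous 0 hc)
    have h := decompose_mul_eq 𝒜 b c
    constructor
    · rw [smul_eq_mul, h.2, ← even_comm 𝒜 (decompose 𝒜 c 0).2]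
      exact add_mem (Submodule.smul_mem_smul (N := gradedPart 𝒜 1) hb0 (decompose 𝒜 c 1).2)
        (Submodule.smul_mem_smul (N := gradedPart 𝒜 1) hc0 (decompose 𝒜 b 1).2)
    · have h' : evenToBar 𝒜 (decompose 𝒜 (b • c) 0) =
          evenToBar 𝒜 (decompose 𝒜 b 0) * evenToBar 𝒜 (decompose 𝒜 c 0) := by
        rw [← map_mul, ← sub_eq_zero, ← map_sub, ← RingHom.mem_ker, mem_ker_evenToBar]
        have h2 : ((decompose 𝒜 (b • c) 0 - decompose 𝒜 b 0 * decompose 𝒜 c 0 : 𝒜 0) : A) =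
            decompose 𝒜 b 1 * (decompose 𝒜 c 1 : A) := by
          change (decompose 𝒜 (b * c) 0 : A) - decompose 𝒜 b 0 * (decompose 𝒜 c 0 : A) = _
          rw [h.1, add_sub_cancel_left]
        rw [h2]
        exact Ideal.mul_mem_left _ _ (Ideal.subset_span (decompose 𝒜 c 1).2)
      rw [h', sq]
      exact Ideal.mul_mem_mul ((evenToBar_mem_maximalIdeal_iff 𝒜).2 hb0)
        ((evenToBar_mem_maximalIdeal_iff 𝒜).2 hc0)
  | add b _ c _ hb hc =>
    rw [decompose_add, DirectSum.add_apply, DirectSum.add_apply, AddSubgroup.coe_add]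
    exact ⟨add_mem hb.1 hc.1, by rw [map_add]; exact add_mem hb.2 hc.2⟩

theorem odd_mem_sq_iff {y : A} (hy : y ∈ 𝒜 1) :
    y ∈ (maximalSuperIdeal 𝒜).toIdeal ^ 2 ↔ y ∈ maximalIdeal (𝒜 0) • gradedPart 𝒜 1 := by
  constructor
  · intro h
    have h' := (decompose_of_mem_sq 𝒜 h).1
    rwa [decompose_of_mem_same 𝒜 hy] at h'
  · intro h
    induction h using Submodule.smul_induction_on' with
    | smul r hr z hz =>
      exact mul_mem_sq 𝒜 ((mem_maximalIdeal_even 𝒜).1 hr) (odd_mem_maximalSuperIdeal 𝒜 hz)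
    | add z hz w hw hz' hw' =>
      exact add_mem (hz' (Submodule.smul_le_right hz)) (hw' (Submodule.smul_le_right hw))

/-- The even part of `c * y`, with `y` odd, is `c₁ * y`, a product of two elements of `𝔪`. So
passing to the quotient by the odd ideal does not change the even cotangent component. -/
theorem decompose_zero_mem_sq_of_mem_oddIdeal {a : A} (ha : a ∈ oddIdeal 𝒜) :
    (decompose 𝒜 a 0 : A) ∈ (maximalSuperIdeal 𝒜).toIdeal ^ 2 := by
  have ha' := mem_top_mul_of_mem_oddIdeal 𝒜 ha
  clear ha
  induction ha' using Submodule.mul_induction_on' with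
  | mem_mul_mem c _ y hy =>
    have hy' : y ∈ 𝒜 1 := hy
    rw [(decompose_mul_eq 𝒜 c y).1, decompose_of_mem_ne 𝒜 hy' (by decide), mul_zero, zero_add]
    exact mul_mem_sq 𝒜 (odd_mem_maximalSuperIdeal 𝒜 (SetLike.coe_mem _))
      (odd_mem_maximalSuperIdeal 𝒜 (SetLike.coe_mem _))
  | add a _ b _ ha hb =>
    rw [decompose_add, DirectSum.add_apply, AddSubgroup.coe_add]
    exact add_mem ha hb

theorem even_mem_sq_iff {r : 𝒜 0} :
    (r : A) ∈ (maximalSuperIdeal 𝒜).toIdeal ^ 2 ↔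
      evenToBar 𝒜 r ∈ maximalIdeal (A ⧸ oddIdeal 𝒜) ^ 2 := by
  have hdec : ∀ s : 𝒜 0, decompose 𝒜 (s : A) 0 = s := fun s =>
    Subtype.ext (decompose_of_mem_same 𝒜 s.2)
  constructor
  · intro h
    have h' := (decompose_of_mem_sq 𝒜 h).2
    rwa [hdec] at h'
  · intro h
    rw [← map_evenToBar_maximalIdeal, ← Ideal.map_pow,
      Ideal.mem_map_iff_of_surjective _ (evenToBar_surjective 𝒜)] at h
    obtain ⟨s, hs, hsr⟩ := h
    have h1 : (s : A) ∈ (maximalSuperIdeal 𝒜).toIdeal ^ 2 := by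
      rw [sq] at hs
      refine Submodule.mul_induction_on hs (fun a ha b hb => ?_) (fun a b ha hb => ?_)
      · exact mul_mem_sq 𝒜 ((mem_maximalIdeal_even 𝒜).1 ha) ((mem_maximalIdeal_even 𝒜).1 hb)
      · exact add_mem ha hb
    have h2 : ((r - s : 𝒜 0) : A) ∈ oddIdeal 𝒜 := by
      rw [← mem_ker_evenToBar, RingHom.mem_ker, map_sub, hsr, sub_self]
    have h3 := decompose_zero_mem_sq_of_mem_oddIdeal 𝒜 h2
    rw [hdec] at h3
    have h4 := add_mem h3 h1
    rwa [← AddSubgroup.coe_add, sub_add_cancel] at h4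

theorem evenToQuotient_eq_zero_iff {r : 𝒜 0} :
    evenToQuotient 𝒜 (maximalSuperIdeal 𝒜) r = 0 ↔ r ∈ maximalIdeal (𝒜 0) := by
  rw [maximalIdeal_even_eq_ker, RingHom.mem_ker]

/-- The odd component is `𝒜 1` modulo `𝔪₀ 𝒜 1`, and Nakayama identifies its dimension with the least
number of generators. -/
theorem finrank_cotangentComponent_one [IsNoetherianSuperRing 𝒜] :
    Module.finrank (A ⧸ (maximalSuperIdeal 𝒜).toIdeal)
      (cotangentComponent 𝒜 (maximalSuperIdeal 𝒜) 1) = (gradedPart 𝒜 1).spanFinrank := by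
  have hfg : (gradedPart 𝒜 1).FG := by
    have := isNoetherian_gradedPart 𝒜 1
    exact Module.Finite.iff_fg.1 inferInstance
  rw [cotangentComponent_one, IsLocalRing.spanFinrank_eq_finrank_quotient _ hfg]
  let g : gradedPart 𝒜 1 →ₛₗ[Ideal.Quotient.mk (maximalIdeal (𝒜 0))]
      gradedPart 𝒜 1 ⧸ maximalIdeal (𝒜 0) • (⊤ : Submodule (𝒜 0) (gradedPart 𝒜 1)) :=
    { toFun := Submodule.Quotient.mk
      map_add' := fun _ _ => rfl
      map_smul' := fun _ _ => rfl }
  refine Module.finrank_eq_of_surjective_of_ker_eq (evenToQuotient_maximal_surjective 𝒜)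
    Ideal.Quotient.mk_surjective (fun r => ?_) (oddCotangent 𝒜).rangeRestrict g
    (oddCotangent 𝒜).surjective_rangeRestrict (Submodule.Quotient.mk_surjective _) (fun y => ?_)
  · rw [evenToQuotient_eq_zero_iff, Ideal.Quotient.eq_zero_iff_mem]
  · rw [← Submodule.coe_eq_zero]
    change oddCotangent 𝒜 y = 0 ↔ (Submodule.Quotient.mk y : gradedPart 𝒜 1 ⧸ _) = 0
    rw [oddCotangent_eq_zero_iff, odd_mem_sq_iff 𝒜 y.2, Submodule.Quotient.mk_eq_zero,
      Submodule.mem_smul_top_iff]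

theorem finrank_cotangentComponent_zero :
    Module.finrank (A ⧸ (maximalSuperIdeal 𝒜).toIdeal)
      (cotangentComponent 𝒜 (maximalSuperIdeal 𝒜) 0) =
    Module.finrank (ResidueField (A ⧸ oddIdeal 𝒜)) (CotangentSpace (A ⧸ oddIdeal 𝒜)) := by
  rw [cotangentComponent_zero]
  let g : maximalIdeal (𝒜 0) →ₛₗ[(residue (A ⧸ oddIdeal 𝒜)).comp (evenToBar 𝒜)]
      CotangentSpace (A ⧸ oddIdeal 𝒜) :=
    { toFun := fun r => (maximalIdeal (A ⧸ oddIdeal 𝒜)).toCotangent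
        ⟨evenToBar 𝒜 r, (evenToBar_mem_maximalIdeal_iff 𝒜).2 r.2⟩
      map_add' := fun r s => by
        rw [← map_add]
        exact congrArg _ (Subtype.ext (map_add (evenToBar 𝒜) _ _))
      map_smul' := fun r s => by
        have h : (⟨evenToBar 𝒜 (r • s : maximalIdeal (𝒜 0)),
            (evenToBar_mem_maximalIdeal_iff 𝒜).2 (r • s).2⟩ :
            maximalIdeal (A ⧸ oddIdeal 𝒜)) = evenToBar 𝒜 r •
            ⟨evenToBar 𝒜 s, (evenToBar_mem_maximalIdeal_iff 𝒜).2 s.2⟩ :=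
          Subtype.ext (map_mul (evenToBar 𝒜) _ _)
        rw [h, map_smul]
        rfl }
  refine Module.finrank_eq_of_surjective_of_ker_eq (evenToQuotient_maximal_surjective 𝒜)
    (residue_surjective.comp (evenToBar_surjective 𝒜)) (fun r => ?_)
    (evenCotangent 𝒜).rangeRestrict g (evenCotangent 𝒜).surjective_rangeRestrict (fun v => ?_)
    (fun y => ?_)
  · rw [evenToQuotient_eq_zero_iff, RingHom.comp_apply, residue_eq_zero_iff,
      evenToBar_mem_maximalIdeal_iff]
  · obtain ⟨⟨c, hc⟩, rfl⟩ := (maximalIdeal (A ⧸ oddIdeal 𝒜)).toCotangent_surjective v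
    obtain ⟨r, rfl⟩ := evenToBar_surjective 𝒜 c
    exact ⟨⟨r, (evenToBar_mem_maximalIdeal_iff 𝒜).1 hc⟩, rfl⟩
  · rw [← Submodule.coe_eq_zero]
    change evenCotangent 𝒜 y = 0 ↔ (maximalIdeal (A ⧸ oddIdeal 𝒜)).toCotangent
        ⟨evenToBar 𝒜 y, (evenToBar_mem_maximalIdeal_iff 𝒜).2 y.2⟩ = 0
    rw [evenCotangent_eq_zero_iff, even_mem_sq_iff, Ideal.toCotangent_eq_zero]

theorem evenKrullDim_eq_iff_isRegularLocalRing [IsNoetherianSuperRing 𝒜] :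
    evenKrullDim 𝒜 = (Module.finrank (A ⧸ (maximalSuperIdeal 𝒜).toIdeal)
      (cotangentComponent 𝒜 (maximalSuperIdeal 𝒜) 0) : ℕ) ↔
    IsRegularLocalRing (A ⧸ oddIdeal 𝒜) := by
  rw [IsRegularLocalRing.iff_finrank_cotangentSpace, finrank_cotangentComponent_zero, evenKrullDim,
    ringKrullDim_bar, eq_comm]

end SuperRing

end Cotangent

/-! ### Systems of odd parameters and annihilators of products. -/

section OddParameters

open DirectSum IsLocalRing

variable {A : Type*} [Ring A] (𝒜 : ZMod 2 → AddSubgroup A) [GradedRing 𝒜] [IsSuperCommutative 𝒜]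

namespace SuperRing

theorem mem_evenAnnihilator {a : A} {r : 𝒜 0} : r ∈ evenAnnihilator 𝒜 a ↔ (r : A) * a = 0 :=
  Iff.rfl

theorem isSystemOfOddParameters_of_le {s : ℕ} (y : Fin s → 𝒜 1)
    (h : ringKrullDim (𝒜 0) ≤
      ringKrullDim (𝒜 0 ⧸ evenAnnihilator 𝒜 (List.ofFn fun i => (y i : A)).prod)) :
    IsSystemOfOddParameters 𝒜 y :=
  le_antisymm h (ringKrullDim_quotient_le _)

theorem isSystemOfOddParameters_zero (y : Fin 0 → 𝒜 1) : IsSystemOfOddParameters 𝒜 y := by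
  have h : evenAnnihilator 𝒜 (List.ofFn fun i => (y i : A)).prod = ⊥ := by
    rw [eq_bot_iff]
    intro r hr
    rw [mem_evenAnnihilator, List.ofFn_zero, List.prod_nil, mul_one] at hr
    exact Subtype.ext hr
  rw [IsSystemOfOddParameters, h]
  exact (ringKrullDim_eq_of_ringEquiv (RingEquiv.quotientBot (𝒜 0))).symm

/-- The product is zero, so the quotient by its annihilator is the zero ring, of dimension `⊥`,
whereas `𝒜 0` has dimension at least `0`. -/
theorem not_isSystemOfOddParameters_of_lt [Nontrivial (𝒜 0)] {t : ℕ} {x : Fin t → gradedPart 𝒜 1}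
    (hx : Submodule.span (𝒜 0) (Set.range x) = ⊤) {s : ℕ} (hs : t < s) (y : Fin s → 𝒜 1) :
    ¬ IsSystemOfOddParameters 𝒜 y := by
  intro h
  have h0 := prod_mem_gradedPart_one_pow 𝒜 y
  rw [gradedPart_one_pow_eq_bot 𝒜 hx hs, Submodule.mem_bot] at h0
  have htop : evenAnnihilator 𝒜 (List.ofFn fun i => (y i : A)).prod = ⊤ := by
    rw [eq_top_iff]
    intro r _
    rw [mem_evenAnnihilator, h0, mul_zero]
  rw [IsSystemOfOddParameters, htop] at h
  have : Subsingleton (𝒜 0 ⧸ (⊤ : Ideal (𝒜 0))) := Ideal.Quotient.subsingleton_iff.2 rfl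
  rw [ringKrullDim_eq_bot_of_subsingleton (R := 𝒜 0 ⧸ (⊤ : Ideal (𝒜 0)))] at h
  have h2 := ringKrullDim_nonneg_of_nontrivial (R := 𝒜 0)
  rw [h] at h2
  exact absurd h2 (by simp)

theorem oddKrullDim_le [Nontrivial (𝒜 0)] {t : ℕ} {x : Fin t → gradedPart 𝒜 1}
    (hx : Submodule.span (𝒜 0) (Set.range x) = ⊤) : oddKrullDim 𝒜 ≤ t := by
  refine iSup₂_le fun s ⟨y, hy⟩ => ?_
  by_contra h
  have h' : t < s := by exact_mod_cast not_le.1 h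
  exact not_isSystemOfOddParameters_of_lt 𝒜 hx h' y hy

theorem oddKrullDim_eq_iff [Nontrivial (𝒜 0)] {t : ℕ} {x : Fin t → gradedPart 𝒜 1}
    (hx : Submodule.span (𝒜 0) (Set.range x) = ⊤) :
    oddKrullDim 𝒜 = t ↔ ∃ y : Fin t → 𝒜 1, IsSystemOfOddParameters 𝒜 y := by
  constructor
  · intro h
    -- For `t = 0` the bound `t - 1` below would truncate; the empty system serves instead.
    rcases Nat.eq_zero_or_pos t with rfl | ht
    · exact ⟨Fin.elim0, isSystemOfOddParameters_zero 𝒜 _⟩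
    by_contra hcon
    have hle : oddKrullDim 𝒜 ≤ ((t - 1 : ℕ) : ℕ∞) := by
      refine iSup₂_le fun s ⟨y, hy⟩ => ?_
      have h1 : s ≤ t := by
        by_contra h'
        exact not_isSystemOfOddParameters_of_lt 𝒜 hx (not_le.1 h') y hy
      have h2 : s ≠ t := by
        rintro rfl
        exact hcon ⟨y, hy⟩
      exact_mod_cast (by omega : s ≤ t - 1)
    rw [h] at hle
    have : t ≤ t - 1 := by exact_mod_cast hle
    omega
  · intro h
    exact le_antisymm (oddKrullDim_le 𝒜 hx)
      (le_iSup₂_of_le (f := fun (s : ℕ) (_ : ∃ y : Fin s → 𝒜 1, IsSystemOfOddParameters 𝒜 y) =>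
        (s : ℕ∞)) t h le_rfl)

instance ringHomSurjective_evenToBar : RingHomSurjective (evenToBar 𝒜) :=
  ⟨evenToBar_surjective 𝒜⟩

theorem map_oddClass_span (s : Set (gradedPart 𝒜 1)) :
    (Submodule.span (𝒜 0) s).map (oddClass 𝒜) =
      Submodule.span (A ⧸ oddIdeal 𝒜) (oddClass 𝒜 '' s) :=
  Submodule.map_span _ _

theorem span_oddClass_eq_top {t : ℕ} {x : Fin t → gradedPart 𝒜 1}
    (hx : Submodule.span (𝒜 0) (Set.range x) = ⊤) :
    Submodule.span (A ⧸ oddIdeal 𝒜) (Set.range fun i => oddClass 𝒜 (x i)) = ⊤ := by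
  have h := map_oddClass_span 𝒜 (Set.range x)
  rw [hx, Submodule.map_top, LinearMap.range_eq_top.2 (oddClass_surjective 𝒜),
    ← Set.range_comp] at h
  exact h.symm

/-- If the annihilator of the product of generators of the odd part consists of elements of the
ideal generated by the odd elements, then the classes of the generators are linearly independent. -/
theorem linearIndependent_oddClass {t : ℕ} {x : Fin t → gradedPart 𝒜 1}
    (hx : Submodule.span (𝒜 0) (Set.range x) = ⊤)
    (hann : evenAnnihilator 𝒜 (List.ofFn fun i => (x i : A)).prod ≤ RingHom.ker (evenToBar 𝒜)) :
    LinearIndependent (A ⧸ oddIdeal 𝒜) fun i => oddClass 𝒜 (x i) := by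
  let b := Pi.basisFun (A ⧸ oddIdeal 𝒜) (Fin t)
  let g : (Fin t → A ⧸ oddIdeal 𝒜) →ₗ[A ⧸ oddIdeal 𝒜] GrPiece (oddIdeal 𝒜) 1 :=
    Fintype.linearCombination (A ⧸ oddIdeal 𝒜) fun i => oddClass 𝒜 (x i)
  have hgb : ∀ i, g (b i) = oddClass 𝒜 (x i) := by
    intro i
    simp [g, b, Fintype.linearCombination_apply_single]
  -- Freeness of `I / I ^ 2` is not yet available, so the injectivity criterion is applied over the
  -- free module on `t` generators. The degree one part of `f` is `g`, hence `g` is injective.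
  let f := (exteriorToGr 𝒜).comp (ExteriorAlgebra.map g)
  have hf : Function.Injective f := by
    refine ExteriorAlgebra.injective_of_top (B := AssocGr (oddIdeal 𝒜)) b f fun c hc => ?_
    obtain ⟨r, rfl⟩ := evenToBar_surjective 𝒜 c
    have h1 : f (ExteriorAlgebra.ιMulti _ t b) = exteriorToGr 𝒜
        (ExteriorAlgebra.ιMulti (A ⧸ oddIdeal 𝒜) t fun i => oddClass 𝒜 (x i)) := by
      change exteriorToGr 𝒜 (ExteriorAlgebra.map g _) = _
      rw [ExteriorAlgebra.map_apply_ιMulti]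
      exact congrArg (fun v => exteriorToGr 𝒜 (ExteriorAlgebra.ιMulti _ t v)) (funext hgb)
    rw [h1, smul_exteriorToGr_ιMulti_eq_zero_iff, oddIdeal_pow_eq_bot 𝒜 hx] at hc
    exact hann hc
  rw [Fintype.linearIndependent_iff]
  intro v hv
  have hv' : f (ExteriorAlgebra.ι _ v) = 0 := by
    change exteriorToGr 𝒜 (ExteriorAlgebra.map g _) = _
    rw [ExteriorAlgebra.map_apply_ι, show g v = 0 from hv, map_zero, map_zero]
  rw [map_eq_zero_iff f hf, ExteriorAlgebra.ι_eq_zero_iff] at hv'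
  exact congrFun hv'

theorem exteriorToGr_injective {t : ℕ} {x : Fin t → gradedPart 𝒜 1}
    (hx : Submodule.span (𝒜 0) (Set.range x) = ⊤)
    (hann : evenAnnihilator 𝒜 (List.ofFn fun i => (x i : A)).prod ≤ RingHom.ker (evenToBar 𝒜)) :
    Function.Injective (exteriorToGr 𝒜) := by
  let b := Module.Basis.mk (linearIndependent_oddClass 𝒜 hx hann)
    (span_oddClass_eq_top 𝒜 hx).ge
  have hb : (b : Fin t → GrPiece (oddIdeal 𝒜) 1) = fun i => oddClass 𝒜 (x i) :=
    Module.Basis.coe_mk _ _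
  refine ExteriorAlgebra.injective_of_top (B := AssocGr (oddIdeal 𝒜)) b _ fun c hc => ?_
  obtain ⟨r, rfl⟩ := evenToBar_surjective 𝒜 c
  rw [hb, smul_exteriorToGr_ιMulti_eq_zero_iff, oddIdeal_pow_eq_bot 𝒜 hx] at hc
  exact hann hc

/-- The top product of a basis belongs to a basis of the exterior algebra, so only the scalar zero
kills it, and injectivity carries this over to the graded ring. -/
theorem evenAnnihilator_prod_le_ker {t : ℕ} {x : Fin t → gradedPart 𝒜 1}
    (b : Module.Basis (Fin t) (A ⧸ oddIdeal 𝒜) (GrPiece (oddIdeal 𝒜) 1))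
    (hb : ∀ i, b i = oddClass 𝒜 (x i)) (hinj : Function.Injective (exteriorToGr 𝒜)) :
    evenAnnihilator 𝒜 (List.ofFn fun i => (x i : A)).prod ≤ RingHom.ker (evenToBar 𝒜) := by
  intro r hr
  rw [mem_evenAnnihilator] at hr
  have h1 := (smul_exteriorToGr_ιMulti_eq_zero_iff 𝒜 x r).2 (by rw [hr]; exact zero_mem _)
  rw [← map_smul, map_eq_zero_iff _ hinj, ← funext hb] at h1
  have h2 : b.ExteriorAlgebra Finset.univ = ExteriorAlgebra.ιMulti (A ⧸ oddIdeal 𝒜) t b := by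
    rw [ExteriorAlgebra.basis_apply_ofCard b (Finset.card_fin t),
      ExteriorAlgebra.ιMulti_family_top]
  have h3 := congrArg (fun z => b.ExteriorAlgebra.repr z Finset.univ) h1
  simpa [← h2] using h3

theorem ker_evenToBar_le_evenAnnihilator {t : ℕ} {x : Fin t → gradedPart 𝒜 1}
    (hx : Submodule.span (𝒜 0) (Set.range x) = ⊤) :
    RingHom.ker (evenToBar 𝒜) ≤ evenAnnihilator 𝒜 (List.ofFn fun i => (x i : A)).prod := by
  intro r hr
  rw [mem_ker_evenToBar] at hr
  have h : (r : A) * (List.ofFn fun i => (x i : A)).prod ∈ oddIdeal 𝒜 ^ (1 + t) :=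
    GrPiece.mul_mem_pow (by rwa [Submodule.pow_one]) (prod_mem_oddIdeal_pow 𝒜 x)
  rw [add_comm, oddIdeal_pow_eq_bot 𝒜 hx] at h
  exact h

/-- The product of the `y i` is an even multiple of that of the `x i`. Generators thus have the
smallest annihilator, and they are odd parameters as soon as some family of length `t` is. -/
theorem evenAnnihilator_prod_le_of_generators {t : ℕ} {x : Fin t → gradedPart 𝒜 1}
    (hx : Submodule.span (𝒜 0) (Set.range x) = ⊤) (y : Fin t → 𝒜 1) :
    evenAnnihilator 𝒜 (List.ofFn fun i => (x i : A)).prod ≤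
      evenAnnihilator 𝒜 (List.ofFn fun i => (y i : A)).prod := by
  intro r hr
  have h := prod_mem_gradedPart_one_pow 𝒜 y
  rw [gradedPart_one_pow_eq_span 𝒜 hx, Submodule.mem_span_singleton] at h
  obtain ⟨c, hc⟩ := h
  rw [mem_evenAnnihilator] at hr ⊢
  rw [← hc, even_smul_def, ← mul_assoc, even_comm 𝒜 r.2, mul_assoc, hr, mul_zero]

/-- The quotient by the odd ideal has the full dimension of `𝒜 0` and is itself a quotient of `𝒜 0`
modulo the annihilator. -/
theorem isSystemOfOddParameters_of_evenAnnihilator_le {t : ℕ} (y : Fin t → 𝒜 1)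
    (h : evenAnnihilator 𝒜 (List.ofFn fun i => (y i : A)).prod ≤ RingHom.ker (evenToBar 𝒜)) :
    IsSystemOfOddParameters 𝒜 y := by
  apply isSystemOfOddParameters_of_le
  rw [ringKrullDim_bar, ← ringKrullDim_eq_of_ringEquiv
    (RingHom.quotientKerEquivOfSurjective (evenToBar_surjective 𝒜))]
  exact ringKrullDim_le_of_surjective (Ideal.Quotient.factor h) (Ideal.Quotient.factor_surjective h)

theorem exists_generators_odd [IsNoetherianSuperRing 𝒜] :
    ∃ x : Fin (gradedPart 𝒜 1).spanFinrank → gradedPart 𝒜 1,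
      Submodule.span (𝒜 0) (Set.range x) = ⊤ := by
  have := isNoetherian_gradedPart 𝒜 1
  obtain ⟨s, hs, hspan⟩ := Submodule.FG.exists_span_finset_card_eq_spanFinrank
    (p := (⊤ : Submodule (𝒜 0) (gradedPart 𝒜 1))) (IsNoetherian.noetherian _)
  rw [Submodule.spanFinrank_top] at hs
  refine ⟨fun i => (s.equivFinOfCardEq hs).symm i, ?_⟩
  rw [← hspan]
  congr 1
  rw [show (fun i => ((s.equivFinOfCardEq hs).symm i : gradedPart 𝒜 1)) =
    Subtype.val ∘ (s.equivFinOfCardEq hs).symm from rfl, Set.range_comp,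
    (s.equivFinOfCardEq hs).symm.surjective.range_eq, Set.image_univ]
  exact Subtype.range_coe

variable [IsLocalSuperRing 𝒜]

/-- Nakayama applies because an odd element of `I ^ 2 ⊆ 𝔪 ^ 2` lies in `𝔪₀ 𝒜 1`. -/
theorem span_eq_top_of_span_oddClass [IsNoetherianSuperRing 𝒜] {s : Set (gradedPart 𝒜 1)}
    (hs : Submodule.span (A ⧸ oddIdeal 𝒜) (oddClass 𝒜 '' s) = ⊤) :
    Submodule.span (𝒜 0) s = ⊤ := by
  have := isNoetherian_gradedPart 𝒜 1
  rw [eq_top_iff]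
  refine Submodule.le_of_le_smul_of_le_jacobson_bot (IsNoetherian.noetherian _)
    (maximalIdeal_le_jacobson ⊥) fun y _ => ?_
  have hy : oddClass 𝒜 y ∈ (Submodule.span (𝒜 0) s).map (oddClass 𝒜) := by
    rw [map_oddClass_span, hs]; trivial
  obtain ⟨z, hz, hzy⟩ := hy
  have h1 : oddClass 𝒜 (y - z) = 0 := by rw [map_sub, hzy, sub_self]
  rw [oddClass_eq_zero_iff, Submodule.pow_succ, Submodule.pow_one] at h1
  have hle : oddIdeal 𝒜 ≤ (maximalSuperIdeal 𝒜).toIdeal :=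
    Ideal.span_le.2 fun y hy => odd_mem_maximalSuperIdeal 𝒜 hy
  have h2 : ((y - z : gradedPart 𝒜 1) : A) ∈ (maximalSuperIdeal 𝒜).toIdeal ^ 2 := by
    refine Submodule.smul_induction_on h1 (fun a ha b hb => ?_) (fun a b ha hb => add_mem ha hb)
    exact mul_mem_sq 𝒜 (hle ha) (hle hb)
  rw [odd_mem_sq_iff 𝒜 (y - z).2, ← Submodule.mem_smul_top_iff] at h2
  rw [← sub_add_cancel y z, add_comm]
  exact Submodule.add_mem_sup hz h2

theorem finite_grPiece_one [IsNoetherianSuperRing 𝒜] :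
    Module.Finite (A ⧸ oddIdeal 𝒜) (GrPiece (oddIdeal 𝒜) 1) := by
  obtain ⟨x, hx⟩ := exists_generators_odd 𝒜
  exact ⟨(span_oddClass_eq_top 𝒜 hx) ▸ Submodule.fg_span (Set.finite_range _)⟩

theorem spanFinrank_odd_eq_finrank [IsNoetherianSuperRing 𝒜]
    [Module.Free (A ⧸ oddIdeal 𝒜) (GrPiece (oddIdeal 𝒜) 1)] :
    (gradedPart 𝒜 1).spanFinrank =
      Module.finrank (A ⧸ oddIdeal 𝒜) (GrPiece (oddIdeal 𝒜) 1) := by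
  have := finite_grPiece_one 𝒜
  have := isNoetherian_gradedPart 𝒜 1
  apply le_antisymm
  · let b := Module.finBasis (A ⧸ oddIdeal 𝒜) (GrPiece (oddIdeal 𝒜) 1)
    choose x hx using fun i => oddClass_surjective 𝒜 (b i)
    have h : Submodule.span (𝒜 0) (Set.range x) = ⊤ := by
      apply span_eq_top_of_span_oddClass
      rw [← Set.range_comp, show oddClass 𝒜 ∘ x = b from funext hx, b.span_eq]
    rw [← Submodule.spanFinrank_top, ← h]
    refine (Submodule.spanFinrank_span_le_ncard_of_finite (Set.finite_range x)).trans ?_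
    rw [← Set.image_univ]
    exact (Set.ncard_image_le Set.finite_univ).trans (by simp [Set.ncard_univ])
  · rw [Module.finrank_eq_spanFinrank_of_free, ← Submodule.spanFinrank_top (gradedPart 𝒜 1)]
    have h := Submodule.spanFinrank_map_le_of_fg (oddClass 𝒜)
      (p := (⊤ : Submodule (𝒜 0) (gradedPart 𝒜 1))) (IsNoetherian.noetherian _)
    rwa [Submodule.map_top, LinearMap.range_eq_top.2 (oddClass_surjective 𝒜)] at h

theorem isRegularLocalSuperRing_iff [IsNoetherianSuperRing 𝒜] :
    IsRegularLocalSuperRing 𝒜 ↔ IsRegularLocalRing (A ⧸ oddIdeal 𝒜) ∧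
      oddKrullDim 𝒜 = ((gradedPart 𝒜 1).spanFinrank : ℕ∞) := by
  rw [IsRegularLocalSuperRing, evenKrullDim_eq_iff_isRegularLocalRing,
    finrank_cotangentComponent_one]

/-- Regularity enters here: the annihilator contains the kernel and its quotient has full dimension,
which over a regular local ring leaves only equality. -/
theorem evenAnnihilator_le_ker_of_oddKrullDim_eq [IsRegularLocalRing (A ⧸ oddIdeal 𝒜)] {t : ℕ}
    {x : Fin t → gradedPart 𝒜 1} (hx : Submodule.span (𝒜 0) (Set.range x) = ⊤)
    (h : oddKrullDim 𝒜 = t) :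
    evenAnnihilator 𝒜 (List.ofFn fun i => (x i : A)).prod ≤ RingHom.ker (evenToBar 𝒜) := by
  obtain ⟨y, hy⟩ := (oddKrullDim_eq_iff 𝒜 hx).1 h
  refine (RingHom.ker_eq_of_ringKrullDim_le (evenToBar 𝒜) (evenToBar_surjective 𝒜)
    (ker_evenToBar_le_evenAnnihilator 𝒜 hx) ?_).le
  rw [← ringKrullDim_bar, hy]
  exact ringKrullDim_le_of_surjective
    (Ideal.Quotient.factor (evenAnnihilator_prod_le_of_generators 𝒜 hx y))
    (Ideal.Quotient.factor_surjective _)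

theorem oddKrullDim_eq_finrank [IsNoetherianSuperRing 𝒜]
    [Module.Free (A ⧸ oddIdeal 𝒜) (GrPiece (oddIdeal 𝒜) 1)]
    (hinj : Function.Injective (exteriorToGr 𝒜)) :
    oddKrullDim 𝒜 = (Module.finrank (A ⧸ oddIdeal 𝒜) (GrPiece (oddIdeal 𝒜) 1) : ℕ∞) := by
  have := finite_grPiece_one 𝒜
  let b := Module.finBasis (A ⧸ oddIdeal 𝒜) (GrPiece (oddIdeal 𝒜) 1)
  choose x hx using fun i => oddClass_surjective 𝒜 (b i)
  have h : Submodule.span (𝒜 0) (Set.range x) = ⊤ := by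
    apply span_eq_top_of_span_oddClass
    rw [← Set.range_comp, show oddClass 𝒜 ∘ x = b from funext hx, b.span_eq]
  rw [oddKrullDim_eq_iff 𝒜 h]
  exact ⟨fun i => ⟨x i, (x i).2⟩, isSystemOfOddParameters_of_evenAnnihilator_le 𝒜 _
    (evenAnnihilator_prod_le_ker 𝒜 b (fun i => (hx i).symm) hinj)⟩

end SuperRing

end OddParameters

/-! ### The equivalence. -/

open SuperRing

theorem mainTheorem2 {A : Type*} [Ring A] (𝒜 : ZMod 2 → AddSubgroup A) [GradedRing 𝒜]
    [IsSuperCommutative 𝒜] [IsNoetherianSuperRing 𝒜] [IsLocalSuperRing 𝒜] :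
    List.TFAE [
      IsRegularLocalSuperRing 𝒜,
      IsRegularLocalRing (A ⧸ oddIdeal 𝒜) ∧
        Module.Free (A ⧸ oddIdeal 𝒜) (GrPiece (oddIdeal 𝒜) 1) ∧
        Function.Bijective (exteriorToGr 𝒜),
      IsRegularLocalRing (A ⧸ oddIdeal 𝒜) ∧
        (Module.Free (A ⧸ oddIdeal 𝒜) (GrPiece (oddIdeal 𝒜) 1) ∧
          (Module.finrank (A ⧸ oddIdeal 𝒜) (GrPiece (oddIdeal 𝒜) 1) : ℕ∞) = oddKrullDim 𝒜) ∧
        Function.Bijective (exteriorToGr 𝒜)] := by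

  tfae_have 1 → 3 := by
    intro h
    obtain ⟨hreg, hodd⟩ := (isRegularLocalSuperRing_iff 𝒜).1 h
    obtain ⟨x, hx⟩ := exists_generators_odd 𝒜
    have hann := evenAnnihilator_le_ker_of_oddKrullDim_eq 𝒜 hx hodd
    have hfree : Module.Free (A ⧸ oddIdeal 𝒜) (GrPiece (oddIdeal 𝒜) 1) :=
      Module.Free.of_basis (Module.Basis.mk (linearIndependent_oddClass 𝒜 hx hann)
        (span_oddClass_eq_top 𝒜 hx).ge)
    exact ⟨hreg, ⟨hfree, by rw [hodd, spanFinrank_odd_eq_finrank]⟩,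
      exteriorToGr_injective 𝒜 hx hann, exteriorToGr_surjective 𝒜⟩
  tfae_have 3 → 2 := fun ⟨hreg, ⟨hfree, _⟩, hbij⟩ => ⟨hreg, hfree, hbij⟩
  tfae_have 2 → 1 := by
    rintro ⟨hreg, hfree, hbij⟩
    refine (isRegularLocalSuperRing_iff 𝒜).2 ⟨hreg, ?_⟩
    rw [oddKrullDim_eq_finrank 𝒜 hbij.1, spanFinrank_odd_eq_finrank]
  tfae_finish
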